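/- For a knot $K$ in $S^3$ let $c(K)$ be its crossing number, that is, the least number of crossings of a diagram of $K$, and let $a_2(K)$ be the coefficient of $z^2$ in its Conway polynomial $\nabla_K(z)$. If $K$ is non-trivial, then \[ a_2(K) \leq \frac{c(K)^{2}-1}{8}. \] The bound is optimal: for every odd integer $p$ with $|p| \geq 3$, the $(2,p)$-torus knot $K$ is non-trivial and satisfies $a_2(K) = \frac{c(K)^2-1}{8}$. -/

import Mathlib

/-!
# Oriented knots, crossing number and Conway polynomial through signed Gauss codes

An oriented diagram is recorded by its signed Gauss code: walk once along each component and note,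
at every passage through a crossing, the name of the crossing, whether one passes over or under,
and the sign of the crossing. On the sphere, a diagram of a knot is determined, up to orientation
preserving homeomorphism, by its signed Gauss code, and a signed Gauss code comes from a diagram on
the sphere if and only if the surface that is obtained by gluing discs to its faces has Euler
characteristic 2. Knots are diagrams modulo the Reidemeister moves.
-/

/-- One passage through a crossing: its label, whether the passage is the upper one, and the
sign of the crossing. -/
@[ext]
structure GaussLetter where
  /-- label of the crossing -/
  crossing : ℕ
  /-- `true` for the upper passage, `false` for the lower one -/
  upper : Bool
  /-- sign of the crossing: the upper strand, turned counterclockwise, reaches the lower strand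
  through an angle less than `π` if the sign is `1`, and the other way round if it is `-1` -/
  sign : ℤˣ
deriving DecidableEq

namespace GaussLetter

/-- The other passage through the same crossing. -/
def flip (x : GaussLetter) : GaussLetter := ⟨x.crossing, !x.upper, x.sign⟩

/-- Change of a label. -/
def relabel (f : ℕ → ℕ) (x : GaussLetter) : GaussLetter := ⟨f x.crossing, x.upper, x.sign⟩

/-- `1` if the other strand at the crossing goes from the right to the left of this passage, and
`-1` if it goes from the left to the right. -/
def turn (x : GaussLetter) : ℤˣ := if x.upper then x.sign else -x.sign

/-- The passage `y` after the crossing of `x` has been switched: upper and lower strand are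
exchanged there, and the sign is negated. -/
def switchAt (x y : GaussLetter) : GaussLetter :=
  if y.crossing = x.crossing then ⟨y.crossing, !y.upper, -y.sign⟩ else y

end GaussLetter

/-- The signed Gauss code of a knot diagram with a base point, read as a cyclic word. -/
abbrev GaussCode := List GaussLetter

namespace GaussCode

/-- Every crossing is passed exactly twice, once over and once under, with one sign. -/
structure Valid (w : GaussCode) : Prop where
  nodup : w.Nodup
  flip_mem : ∀ x ∈ w, x.flip ∈ w
  sign_eq : ∀ x ∈ w, ∀ y ∈ w, x.crossing = y.crossing → x.sign = y.sign

/-- Number of crossings. -/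
def numCrossings (w : GaussCode) : ℕ := (w.map GaussLetter.crossing).toFinset.card

/-- An edge of the diagram travelled in one of its two directions: `(x, 1)` is the edge that ends
at the passage `x`, travelled along the orientation, and `(x, -1)` is the edge that starts at the
passage `x`, travelled against the orientation. In both cases one arrives at `x`. -/
abbrev Dart (w : GaussCode) := {x : GaussLetter // x ∈ w} × ℤˣ

/-- Arrive at a crossing along the dart `d`, turn left onto the other strand, and follow it to the
next crossing: this is the dart `d'`. Turning left means following the other strand along its
orientation or against it according to `d.2 * d.1.turn`. -/
def FaceStep (w : GaussCode) (d d' : Dart w) : Prop :=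
  d'.2 = d.2 * d.1.1.turn ∧
    ∃ h : d.1.1.flip ∈ w, d'.1.1 = if d'.2 = 1 then w.next _ h else w.prev _ h

/-- Number of faces: each face is the cycle of the darts that have the face on their left. -/
noncomputable def numFaces (w : GaussCode) : ℕ := Nat.card (Quot (FaceStep w))

/-- The diagram lies on the sphere. The code without crossings is the round circle; otherwise
`V - E + F = 2`, where there are as many edges as passages. (The diagram of a knot is connected.) -/
def Planar (w : GaussCode) : Prop :=
  w = [] ∨ w.numCrossings + w.numFaces = w.length + 2

/-- Two letters in the order given by a sign. -/
def pair (s : ℤˣ) (x y : GaussLetter) : GaussCode := if s = 1 then [x, y] else [y, x]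

/-- Elementary changes of a Gauss code: change of the base point, change of the labels, and the
three Reidemeister moves, with all choices of orientations.

In the third move there is a top strand over a middle strand (at the crossing `a`) and over a
bottom strand (at `b`), and the middle strand is over the bottom strand (at `c`). The sign `l` is
`1` if the top strand meets `a` before `b`, the sign `m` is `1` if the middle strand meets `a`
before `c`, and the sign `n` is `1` if the bottom strand meets `b` before `c`. The three equal
products are the orientation of the triangle `a b c`, seen from its three corners, so their equality
says that the three edges between the crossings bound a triangular face. The three strands may
follow each other along the knot in either of the two cyclic orders. -/
inductive Move : GaussCode → GaussCode → Prop
  | rotate (u v : GaussCode) : Move (u ++ v) (v ++ u)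
  | relabel (f : ℕ → ℕ) (hf : Function.Injective f) (w : GaussCode) :
      Move w (w.map (GaussLetter.relabel f))
  | reidemeister1 (x : GaussLetter) (w : GaussCode) : Move ([x, x.flip] ++ w) w
  | reidemeister2_parallel (a b : GaussLetter) (u v : GaussCode)
      (ha : a.upper = true) (hb : b.upper = true) (hab : a.sign = -b.sign) :
      Move ([a, b] ++ u ++ [a.flip, b.flip] ++ v) (u ++ v)
  | reidemeister2_antiparallel (a b : GaussLetter) (u v : GaussCode)
      (ha : a.upper = true) (hb : b.upper = true) (hab : a.sign = -b.sign) :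
      Move ([a, b] ++ u ++ [b.flip, a.flip] ++ v) (u ++ v)
  | reidemeister3_tmb (a b c : GaussLetter) (l m n : ℤˣ) (u v w : GaussCode)
      (ha : a.upper = true) (hb : b.upper = true) (hc : c.upper = true)
      (h₁ : l * m * a.sign = l * n * b.sign) (h₂ : l * n * b.sign = m * n * c.sign) :
      Move
        (pair l a b ++ u ++ pair m a.flip c ++ v ++ pair n b.flip c.flip ++ w)
        (pair (-l) a b ++ u ++ pair (-m) a.flip c ++ v ++ pair (-n) b.flip c.flip ++ w)
  | reidemeister3_tbm (a b c : GaussLetter) (l m n : ℤˣ) (u v w : GaussCode)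
      (ha : a.upper = true) (hb : b.upper = true) (hc : c.upper = true)
      (h₁ : l * m * a.sign = l * n * b.sign) (h₂ : l * n * b.sign = m * n * c.sign) :
      Move
        (pair l a b ++ u ++ pair n b.flip c.flip ++ v ++ pair m a.flip c ++ w)
        (pair (-l) a b ++ u ++ pair (-n) b.flip c.flip ++ v ++ pair (-m) a.flip c ++ w)

/-- The Gauss code of the standard diagram of the `(2,p)`-torus knot for odd `p`, the closure of the
`p`-th power of the generator of the braid group on two strands: the `|p|` crossings have the sign
of `p` and are passed twice in the same order, alternately over and under. -/
def torus (p : ℤ) : GaussCode :=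
  (List.range (2 * p.natAbs)).map fun k =>
    ⟨k % p.natAbs, decide (Even k), if 0 < p then 1 else -1⟩

end GaussCode

/-- The Gauss code of a diagram of an oriented link: one word for each component, with an order of
the components and a base point on each of them. An empty word is a circle without crossings. -/
abbrev LinkCode := List GaussCode

namespace LinkCode

/-- Switch the crossing of `x`. -/
def switch (x : GaussLetter) (L : LinkCode) : LinkCode :=
  L.map fun w => w.map (GaussLetter.switchAt x)

/-- The part of a word before the letter `x`. -/
def before (x : GaussLetter) (w : GaussCode) : GaussCode := w.takeWhile (fun y => y ≠ x)

/-- The part of a word after the letter `x`. -/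
def after (x : GaussLetter) (w : GaussCode) : GaussCode := (w.dropWhile (fun y => y ≠ x)).tail

/-- Smooth the crossing of `x` according to the orientation; here `x` is the first passage through
the crossing, and `y` is the second one.
If both passages are on one component `A x B y C`, then this component splits into `A C` and `B`.
If they are on two components `A x B` and `C y D`, then these are merged into `A D C B`. -/
def smooth (x : GaussLetter) (L : LinkCode) : LinkCode :=
  let y := x.flip
  if ∃ w ∈ L, x ∈ w ∧ y ∈ w then
    L.flatMap fun w =>
      if x ∈ w then [before x w ++ after y w, before y (after x w)] else [w]
  else
    let v := (L.find? fun w => decide (y ∈ w)).getD []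
    (L.filter fun w => decide (y ∉ w)).map fun w =>
      if x ∈ w then before x w ++ after y v ++ before y v ++ after x w else w

/-- The lower passages that come before the upper passage through the same crossing, in the order in
which they are met. The diagram is descending if there are none. -/
def badLetters (L : LinkCode) : List GaussLetter :=
  L.flatten.filter fun x => !x.upper && decide (L.flatten.idxOf x < L.flatten.idxOf x.flip)

/-- Value of the Conway polynomial on the unlink with as many components as `L`. -/
noncomputable def unlinkValue (L : LinkCode) : Polynomial ℤ := if L.length = 1 then 1 else 0

/-- Switch the crossings in the list one after the other, applying the skein relation
`∇(L₊) - ∇(L₋) = z ∇(L₀)` each time, where the values on the smoothed links `L₀` are given by `f`,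
and the diagram after all the switches is one of an unlink. -/
noncomputable def resolve (f : LinkCode → Polynomial ℤ) :
    List GaussLetter → LinkCode → Polynomial ℤ
  | [], L => unlinkValue L
  | x :: xs, L =>
      resolve f xs (switch x L) + (((x.sign : ℤˣ) : ℤ) : Polynomial ℤ) * Polynomial.X * f (smooth x L)

/-- The Conway polynomial of a link diagram with at most `n` crossings, computed from the skein
relation and the values on unlinks: switching the bad crossings makes the diagram descending, hence
one of an unlink, and each smoothing removes a crossing. -/
noncomputable def conway : ℕ → LinkCode → Polynomial ℤ
  | 0, L => unlinkValue L
  | n + 1, L => resolve (conway n) (badLetters L) L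

end LinkCode

/-- Diagrams of oriented knots on the sphere. -/
structure KnotDiagram where
  /-- signed Gauss code -/
  code : GaussCode
  valid : code.Valid
  planar : code.Planar

namespace KnotDiagram

/-- Number of crossings. -/
def numCrossings (D : KnotDiagram) : ℕ := D.code.numCrossings

/-- The Conway polynomial `∇(z)` computed from the diagram. -/
noncomputable def conway (D : KnotDiagram) : Polynomial ℤ :=
  LinkCode.conway D.numCrossings [D.code]

/-- The diagram without crossings. -/
def trivial : KnotDiagram where
  code := []
  valid := ⟨List.nodup_nil, by simp, by simp⟩
  planar := Or.inl rfl

/-- Equivalence of knot diagrams on the sphere: the equivalence relation generated by the moves. -/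
instance setoid : Setoid KnotDiagram :=
  Relation.EqvGen.setoid fun D D' => GaussCode.Move D.code D'.code

end KnotDiagram

/-- Oriented knots: diagrams on the sphere modulo the Reidemeister moves. -/
def Knot : Type := Quotient KnotDiagram.setoid

/-- The knot with a given diagram. -/
def KnotDiagram.knot (D : KnotDiagram) : Knot := Quotient.mk KnotDiagram.setoid D

namespace Knot

/-- The trivial knot. -/
def unknot : Knot := KnotDiagram.trivial.knot

/-- The crossing number: the least number of crossings of a diagram of the knot. -/
noncomputable def crossingNumber (K : Knot) : ℕ :=
  sInf {n : ℕ | ∃ D : KnotDiagram, D.knot = K ∧ D.numCrossings = n}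

/-- The coefficient of `z ^ n` in the Conway polynomial, computed from some diagram of the knot. -/
noncomputable def conwayCoeff (n : ℕ) (K : Knot) : ℤ := (Quotient.out K).conway.coeff n

end Knot

namespace GaussLetter

/-! The coefficient `a₂` is computed by the Polyak-Viro formula (`casson`): a signed count of pairs
of crossings met in the order lower `x`, upper `y`, upper `x`, lower `y`. This holds for the skein
computation of any diagram (`LinkCode.coeff_two_conway`), and the sum does not change under the
moves (`casson_move`), so it can be read from a diagram with the least number `n` of crossings.

Planarity enters through one fact. Euler characteristic 2 forces the first homology to vanish, hence
the knot, as a cycle of edges, is the boundary of a combination of faces. The coefficients of the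
faces are an Alexander numbering (`hasNumbering_of_planar`), and opposite regions at a crossing have
equal numbers, so the turns between the two passages through a crossing add up to zero
(`HasNumbering.sum_turn`). This gives independence of the base point, and also the equality of the
Polyak-Viro sum with its mirror version, in which the passages through `y` start first
(`casson_eq_sum_interlace'`).

For the bound, let `k` crossings be passed first below and `l` first above, with `k + l = n`. Each
of the `k * l` mixed pairs is interlaced in at most one of the two orders. Adding the two formulas
gives `2 a₂ ≤ k * l`, that is, `8 a₂ ≤ n² - (k - l)²`. If `k ≠ l`, this is at most `n² - 1`; if `k =
l`, moving the base point past one crossing makes them different (`eight_mul_casson_le`).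

For the torus diagrams the sum is evaluated directly (`two_mul_casson_torusCode`). The value is
non-zero, so the knot is not trivial, and the bound itself then shows that the standard diagram has
the least number of crossings. -/

@[simp] theorem flip_flip (x : GaussLetter) : x.flip.flip = x := by simp [flip]

@[simp] theorem flip_crossing (x : GaussLetter) : x.flip.crossing = x.crossing := rfl

@[simp] theorem flip_sign (x : GaussLetter) : x.flip.sign = x.sign := rfl

@[simp] theorem flip_upper (x : GaussLetter) : x.flip.upper = !x.upper := rfl

theorem flip_ne (x : GaussLetter) : x.flip ≠ x := by
  intro h
  have := congrArg upper h
  simp at this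

theorem ne_flip (x : GaussLetter) : x ≠ x.flip := fun h => x.flip_ne h.symm

theorem flip_injective : Function.Injective flip := fun x y h => by
  rw [← flip_flip x, h, flip_flip]

theorem flip_eq_iff {x y : GaussLetter} : x.flip = y ↔ x = y.flip :=
  ⟨fun h => by rw [← h, flip_flip], fun h => by rw [h, flip_flip]⟩

@[simp] theorem turn_flip (x : GaussLetter) : x.flip.turn = -x.turn := by
  rcases x with ⟨i, _ | _, s⟩ <;> simp [turn, flip]

end GaussLetter

/-! ### Homology of the surface of a code, and Alexander numberings -/

namespace GaussCode

open GaussLetter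

/-- The set of passages of a code as a type. -/
abbrev Passage (w : GaussCode) := {x : GaussLetter // x ∈ w}

/-- The set of crossings of a code as a type. -/
abbrev Crossing (w : GaussCode) := {i : ℕ // i ∈ (w.map GaussLetter.crossing).toFinset}

/-- The faces of a code. -/
abbrev Face (w : GaussCode) := Quot (FaceStep w)

theorem card_passage {w : GaussCode} (hw : w.Nodup) : Fintype.card (Passage w) = w.length := by
  rw [Fintype.card_of_subtype w.toFinset (by simp), List.toFinset_card_of_nodup hw]

theorem card_crossing (w : GaussCode) : Fintype.card (Crossing w) = w.numCrossings := by
  simp [numCrossings]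

/-- The crossing of a passage. -/
def crossingOf (w : GaussCode) (x : Passage w) : Crossing w :=
  ⟨x.1.crossing, by simpa using ⟨x.1, x.2, rfl⟩⟩

/-- The cyclic successor as a permutation. -/
def nextPerm (w : GaussCode) (hw : w.Nodup) : Equiv.Perm (Passage w) where
  toFun x := ⟨w.next x.1 x.2, List.next_mem _ _ x.2⟩
  invFun x := ⟨w.prev x.1 x.2, List.prev_mem _ _ x.2⟩
  left_inv x := Subtype.ext (w.prev_next hw _ x.2)
  right_inv x := Subtype.ext (w.next_prev hw _ x.2)

/-- The other passage through the same crossing as a permutation. -/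
def flipPerm (w : GaussCode) (hw : w.Valid) : Equiv.Perm (Passage w) where
  toFun x := ⟨x.1.flip, hw.flip_mem _ x.2⟩
  invFun x := ⟨x.1.flip, hw.flip_mem _ x.2⟩
  left_inv _ := Subtype.ext (flip_flip _)
  right_inv _ := Subtype.ext (flip_flip _)

/-- A property that is inherited by cyclic successors holds everywhere if it holds somewhere. -/
theorem forall_of_next {w : GaussCode} (hw : w.Nodup) {p : Passage w → Prop}
    (h : ∀ x, p x → p (nextPerm w hw x)) (x y : Passage w) (hx : p x) : p y := by
  obtain ⟨x, hxw⟩ := x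
  obtain ⟨y, hyw⟩ := y
  obtain ⟨i, hi, rfl⟩ := List.getElem_of_mem hxw
  obtain ⟨j, hj, rfl⟩ := List.getElem_of_mem hyw
  have key : ∀ k : ℕ, p ⟨w[(i + k) % w.length]'(Nat.mod_lt _ (by omega)), List.getElem_mem _⟩ := by
    intro k
    induction k with
    | zero => simpa [Nat.mod_eq_of_lt hi] using hx
    | succ k ih =>
      have := h _ ih
      simpa [nextPerm, List.next_getElem w hw, add_assoc] using this
  have := key (j + (w.length - i))
  have e : (i + (j + (w.length - i))) % w.length = j := by
    rw [show i + (j + (w.length - i)) = j + w.length by omega, Nat.add_mod_right,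
      Nat.mod_eq_of_lt hj]
  simpa [e] using this

/-- Functions on faces, pulled back to darts, satisfy these relations at each crossing. -/
theorem face_relation {w : GaussCode} (hw : w.Valid) {α : Type*} (c : Face w → α) (x : Passage w) :
    (x.1.turn = 1 →
      c (Quot.mk _ (x, 1)) = c (Quot.mk _ (nextPerm w hw.nodup (flipPerm w hw x), 1)) ∧
      c (Quot.mk _ (x, -1)) =
        c (Quot.mk _ ((nextPerm w hw.nodup).symm (flipPerm w hw x), -1))) ∧
    (x.1.turn = -1 →
      c (Quot.mk _ (x, 1)) =
        c (Quot.mk _ ((nextPerm w hw.nodup).symm (flipPerm w hw x), -1)) ∧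
      c (Quot.mk _ (x, -1)) = c (Quot.mk _ (nextPerm w hw.nodup (flipPerm w hw x), 1))) := by
  have hm := hw.flip_mem _ x.2
  have hne : (-1 : ℤˣ) ≠ 1 := by decide
  refine ⟨fun h => ⟨?_, ?_⟩, fun h => ⟨?_, ?_⟩⟩ <;> apply congrArg c <;> apply Quot.sound <;>
    refine ⟨by simp [h], hm, ?_⟩ <;> simp [nextPerm, flipPerm, hne]

/-- The boundary of a combination of faces. -/
def boundary (w : GaussCode) (hw : w.Valid) : (Face w → ℚ) →ₗ[ℚ] (Passage w → ℚ) where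
  toFun c x := c (Quot.mk _ (x, 1)) - c (Quot.mk _ ((nextPerm w hw.nodup).symm x, -1))
  map_add' c d := by ext x; simp; ring
  map_smul' r c := by ext x; simp; ring

/-- The coboundary of a combination of crossings. -/
noncomputable def coboundary (w : GaussCode) (hw : w.Valid) :
    (Crossing w → ℚ) →ₗ[ℚ] Module.Dual ℚ (Passage w → ℚ) where
  toFun p :=
    { toFun := fun γ => ∑ x : Passage w,
        (p (crossingOf w x) - p (crossingOf w ((nextPerm w hw.nodup).symm x))) * γ x
      map_add' := fun γ δ => by simp [mul_add, Finset.sum_add_distrib]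
      map_smul' := fun r γ => by
        simp only [Pi.smul_apply, smul_eq_mul, RingHom.id_apply, Finset.mul_sum]
        exact Finset.sum_congr rfl fun x _ => by ring }
  map_add' p q := by
    apply LinearMap.ext; intro γ
    simp only [LinearMap.add_apply, LinearMap.coe_mk, AddHom.coe_mk, Pi.add_apply,
      ← Finset.sum_add_distrib]
    exact Finset.sum_congr rfl fun x _ => by ring
  map_smul' r p := by
    apply LinearMap.ext; intro γ
    simp only [LinearMap.smul_apply, LinearMap.coe_mk, AddHom.coe_mk, Pi.smul_apply, smul_eq_mul,
      RingHom.id_apply, Finset.mul_sum]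
    exact Finset.sum_congr rfl fun x _ => by ring

theorem coboundary_apply (w : GaussCode) (hw : w.Valid) (p : Crossing w → ℚ) (γ : Passage w → ℚ) :
    coboundary w hw p γ = ∑ x : Passage w,
      (p (crossingOf w x) - p (crossingOf w ((nextPerm w hw.nodup).symm x))) * γ x := rfl

theorem boundary_apply (w : GaussCode) (hw : w.Valid) (c : Face w → ℚ) (x : Passage w) :
    boundary w hw c x =
      c (Quot.mk _ (x, 1)) - c (Quot.mk _ ((nextPerm w hw.nodup).symm x, -1)) := rfl

theorem turn_eq_or (x : GaussLetter) : x.turn = 1 ∨ x.turn = -1 := Int.units_eq_one_or _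

/-- The composition of two cellular differentials vanishes: around a crossing, each of the four
corners is counted twice with opposite signs. -/
theorem coboundary_boundary (w : GaussCode) (hw : w.Valid) (p : Crossing w → ℚ)
    (c : Face w → ℚ) : coboundary w hw p (boundary w hw c) = 0 := by
  set σ := nextPerm w hw.nodup with hσ
  set τ := flipPerm w hw with hτ
  -- After summation by parts, `g x` is the coefficient of `p` at the passage `x`: the jump of `c`
  -- across the incoming edge minus that across the outgoing edge. It cancels against the jump at
  -- the other passage through the crossing.
  set g : Passage w → ℚ := fun x =>
    c (Quot.mk _ (x, 1)) - c (Quot.mk _ (σ.symm x, -1)) -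
      (c (Quot.mk _ (σ x, 1)) - c (Quot.mk _ (x, -1))) with hg
  have h₁ : coboundary w hw p (boundary w hw c) = ∑ x, p (crossingOf w x) * g x := by
    rw [coboundary_apply]
    have : ∑ x, p (crossingOf w (σ.symm x)) * boundary w hw c x =
        ∑ x, p (crossingOf w x) * boundary w hw c (σ x) := by
      rw [← Equiv.sum_comp σ]; simp
    simp only [sub_mul, Finset.sum_sub_distrib]
    rw [← hσ, this, ← Finset.sum_sub_distrib]
    refine Finset.sum_congr rfl fun x _ => ?_
    simp only [boundary_apply, hg, ← hσ, Equiv.symm_apply_apply]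
    ring
  have h₂ : ∑ x, p (crossingOf w x) * g (τ x) = ∑ x, p (crossingOf w x) * g x := by
    rw [← Equiv.sum_comp τ fun x => p (crossingOf w x) * g x]
    rfl
  have h₃ : ∀ x, g x + g (τ x) = 0 := by
    intro x
    have ht : τ (τ x) = x := Subtype.ext (flip_flip _)
    have htt : (τ x).1.turn = -x.1.turn := turn_flip _
    have r₁ := face_relation hw c x
    have r₂ := face_relation hw c (τ x)
    rw [← hσ, ← hτ] at r₁ r₂
    rw [ht] at r₂
    simp only [hg]
    rcases turn_eq_or x.1 with h | h
    · obtain ⟨e₁, e₂⟩ := r₁.1 h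
      obtain ⟨e₃, e₄⟩ := r₂.2 (by rw [htt, h])
      rw [e₁, e₂, e₃, e₄]; ring
    · obtain ⟨e₁, e₂⟩ := r₁.2 h
      obtain ⟨e₃, e₄⟩ := r₂.1 (by rw [htt, h, neg_neg])
      rw [e₁, e₂, e₃, e₄]; ring
  have h₄ : ∑ x, p (crossingOf w x) * g x + ∑ x, p (crossingOf w x) * g (τ x) = 0 := by
    rw [← Finset.sum_add_distrib]
    exact Finset.sum_eq_zero fun x _ => by rw [← mul_add, h₃, mul_zero]
  rw [h₁]
  linarith

/-- If the two sides of every edge have equal values, then the face relations at the crossings carry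
the value from one edge to the next, and `c` is constant. -/
theorem finrank_ker_boundary_le (w : GaussCode) (hw : w.Valid) (hne : w ≠ []) :
    Module.finrank ℚ (LinearMap.ker (boundary w hw)) ≤ 1 := by
  set σ := nextPerm w hw.nodup with hσ
  set τ := flipPerm w hw with hτ
  obtain ⟨x₀, hx₀⟩ := List.exists_mem_of_ne_nil w hne
  have hle : LinearMap.ker (boundary w hw) ≤ Submodule.span ℚ {fun _ => (1 : ℚ)} := by
    intro c hc
    have h₀ : ∀ x, c (Quot.mk _ (x, 1)) = c (Quot.mk _ (σ.symm x, -1)) := fun x => by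
      have := congrFun (LinearMap.mem_ker.1 hc) x
      rw [boundary_apply] at this
      simpa [sub_eq_zero] using this
    have h₁ : ∀ x, c (Quot.mk _ (x, -1)) = c (Quot.mk _ (σ x, 1)) := fun x => by
      rw [h₀, Equiv.symm_apply_apply]
    have h₂ : ∀ x, c (Quot.mk _ (σ x, 1)) = c (Quot.mk _ (x, 1)) := by
      intro x
      have ht : τ (τ x) = x := Subtype.ext (flip_flip _)
      have htt : (τ x).1.turn = -x.1.turn := turn_flip _
      have r₁ := face_relation hw c x
      have r₂ := face_relation hw c (τ x)
      rw [← hσ, ← hτ] at r₁ r₂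
      rw [ht] at r₂
      rcases turn_eq_or x.1 with h | h
      · obtain ⟨e₁, e₂⟩ := r₁.1 h
        obtain ⟨e₃, e₄⟩ := r₂.2 (by rw [htt, h])
        rw [← h₁, e₂, ← h₀, e₃, ← h₀]
      · obtain ⟨e₁, e₂⟩ := r₁.2 h
        obtain ⟨e₃, e₄⟩ := r₂.1 (by rw [htt, h, neg_neg])
        rw [← h₁, e₂, ← h₁, e₄, h₁, Equiv.apply_symm_apply]
    have h₃ : ∀ y, c (Quot.mk _ (y, 1)) = c (Quot.mk _ (⟨x₀, hx₀⟩, 1)) := fun y =>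
      forall_of_next hw.nodup (p := fun y => c (Quot.mk _ (y, 1)) = c (Quot.mk _ (⟨x₀, hx₀⟩, 1)))
        (fun x hx => (h₂ x).trans hx) ⟨x₀, hx₀⟩ y rfl
    rw [Submodule.mem_span_singleton]
    refine ⟨c (Quot.mk _ (⟨x₀, hx₀⟩, 1)), ?_⟩
    ext f
    induction f using Quot.ind with
    | mk d =>
      obtain ⟨y, s⟩ := d
      rcases Int.units_eq_one_or s with rfl | rfl
      · simp [h₃]
      · rw [h₁, h₃ (σ y)]; simp
  exact (Submodule.finrank_mono hle).trans ((finrank_span_le_card _).trans (by simp))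

theorem finrank_ker_coboundary_le (w : GaussCode) (hw : w.Valid) (hne : w ≠ []) :
    Module.finrank ℚ (LinearMap.ker (coboundary w hw)) ≤ 1 := by
  set σ := nextPerm w hw.nodup with hσ
  obtain ⟨x₀, hx₀⟩ := List.exists_mem_of_ne_nil w hne
  have hle : LinearMap.ker (coboundary w hw) ≤ Submodule.span ℚ {fun _ => (1 : ℚ)} := by
    intro p hp
    have h₀ : ∀ x, p (crossingOf w (σ x)) = p (crossingOf w x) := fun x => by
      have := LinearMap.congr_fun (LinearMap.mem_ker.1 hp) (Pi.single (σ x) 1)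
      rw [coboundary_apply] at this
      simpa [Pi.single_apply, sub_eq_zero, ← hσ] using this
    have h₃ : ∀ y, p (crossingOf w y) = p (crossingOf w ⟨x₀, hx₀⟩) := fun y =>
      forall_of_next hw.nodup (p := fun y => p (crossingOf w y) = p (crossingOf w ⟨x₀, hx₀⟩))
        (fun x hx => (h₀ x).trans hx) ⟨x₀, hx₀⟩ y rfl
    rw [Submodule.mem_span_singleton]
    refine ⟨p (crossingOf w ⟨x₀, hx₀⟩), ?_⟩
    ext ⟨i, hi⟩
    obtain ⟨y, hy, rfl⟩ : ∃ y ∈ w, y.crossing = i := by simpa using hi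
    have := h₃ ⟨y, hy⟩
    simp only [Pi.smul_apply, smul_eq_mul, mul_one]
    exact this.symm
  exact (Submodule.finrank_mono hle).trans ((finrank_span_le_card _).trans (by simp))

theorem range_coboundary_le (w : GaussCode) (hw : w.Valid) :
    LinearMap.range (coboundary w hw) ≤ (LinearMap.range (boundary w hw)).dualAnnihilator := by
  rintro _ ⟨p, rfl⟩
  rw [Submodule.mem_dualAnnihilator]
  rintro _ ⟨c, rfl⟩
  exact coboundary_boundary w hw p c

theorem numFaces_le_finrank (w : GaussCode) (hw : w.Valid) (hne : w ≠ []) :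
    w.numFaces ≤ Module.finrank ℚ (LinearMap.range (boundary w hw)) + 1 := by
  classical
  have : Fintype (Face w) := Fintype.ofFinite _
  have h := LinearMap.finrank_range_add_finrank_ker (boundary w hw)
  rw [Module.finrank_fintype_fun_eq_card, ← Nat.card_eq_fintype_card] at h
  have := finrank_ker_boundary_le w hw hne
  change Nat.card (Face w) ≤ _
  omega

theorem numCrossings_le_finrank (w : GaussCode) (hw : w.Valid) (hne : w ≠ []) :
    w.numCrossings ≤ Module.finrank ℚ (LinearMap.range (coboundary w hw)) + 1 := by
  have h := LinearMap.finrank_range_add_finrank_ker (coboundary w hw)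
  rw [Module.finrank_fintype_fun_eq_card, card_crossing] at h
  have := finrank_ker_coboundary_le w hw hne
  omega

theorem finrank_boundary_add (w : GaussCode) (hw : w.Valid) :
    Module.finrank ℚ (LinearMap.range (boundary w hw)) +
      Module.finrank ℚ (LinearMap.range (boundary w hw)).dualAnnihilator = w.length := by
  rw [Subspace.finrank_add_finrank_dualAnnihilator_eq, Module.finrank_fintype_fun_eq_card,
    card_passage hw.nodup]

/-- The Euler characteristic of the surface of a code is at most `2`. -/
theorem numCrossings_add_numFaces_le (w : GaussCode) (hw : w.Valid) (hne : w ≠ []) :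
    w.numCrossings + w.numFaces ≤ w.length + 2 := by
  have h₁ := numFaces_le_finrank w hw hne
  have h₂ := numCrossings_le_finrank w hw hne
  have h₃ := Submodule.finrank_mono (range_coboundary_le w hw)
  have h₄ := finrank_boundary_add w hw
  omega

/-- An Alexander numbering: `a x` is the number of the region to the left of the edge that ends
at the passage `x`. -/
def HasNumbering (w : GaussCode) : Prop :=
  ∃ a : GaussLetter → ℚ, ∀ x (hx : x ∈ w),
    a (w.next x hx) = a x - ((x.turn : ℤ) : ℚ) ∧ a (w.next x hx) = a x.flip

/-- Euler characteristic 2 leaves no room between the coboundaries and the annihilator of the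
boundaries. The closed curve has sum zero against every coboundary, so it lies in the double
annihilator of the boundaries, which is their span. -/
theorem one_mem_range_boundary (w : GaussCode) (hw : w.Valid) (hne : w ≠ [])
    (hp : w.Planar) : (fun _ => 1) ∈ LinearMap.range (boundary w hw) := by
  have h₀ := hp.resolve_left hne
  have h₁ := numFaces_le_finrank w hw hne
  have h₂ := numCrossings_le_finrank w hw hne
  have h₃ := finrank_boundary_add w hw
  -- With `V + F = E + 2`, the bounds `F ≤ rank ∂ + 1` and `V ≤ rank δ + 1` give `rank δ ≥ E - rank
  -- ∂`, the dimension of the annihilator.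
  have h₄ : LinearMap.range (coboundary w hw) =
      (LinearMap.range (boundary w hw)).dualAnnihilator :=
    Submodule.eq_of_le_of_finrank_le (range_coboundary_le w hw) (by omega)
  rw [← Subspace.dualAnnihilator_dualCoannihilator_eq (W := LinearMap.range (boundary w hw)), ← h₄,
    Submodule.mem_dualCoannihilator]
  rintro _ ⟨p, rfl⟩
  rw [coboundary_apply]
  simp only [mul_one, Finset.sum_sub_distrib]
  rw [Equiv.sum_comp (nextPerm w hw.nodup).symm fun x => p (crossingOf w x), sub_self]

/-- The numbers are the coefficients of a combination of faces with the knot as boundary. The left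
side of every edge is then one higher than the right side, and the face relations translate this
into the two conditions at a crossing. -/
theorem hasNumbering_of_planar {w : GaussCode} (hw : w.Valid) (hp : w.Planar) :
    w.HasNumbering := by
  by_cases hne : w = []
  · subst hne
    exact ⟨fun _ => 0, fun x hx => by simp at hx⟩
  obtain ⟨c, hc⟩ := one_mem_range_boundary w hw hne hp
  set σ := nextPerm w hw.nodup with hσ
  set τ := flipPerm w hw with hτ
  have h₀ : ∀ x, c (Quot.mk _ (σ.symm x, -1)) = c (Quot.mk _ (x, 1)) - 1 := fun x => by
    have := congrFun hc x
    rw [boundary_apply] at this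
    simp only [← hσ] at this
    linarith
  have h₁ : ∀ x, c (Quot.mk _ (x, -1)) = c (Quot.mk _ (σ x, 1)) - 1 := fun x => by
    rw [← h₀, Equiv.symm_apply_apply]
  have key : ∀ x, c (Quot.mk _ (σ x, 1)) = c (Quot.mk _ (x, 1)) - ((x.1.turn : ℤ) : ℚ) ∧
      c (Quot.mk _ (σ x, 1)) = c (Quot.mk _ (τ x, 1)) := by
    intro x
    have ht : τ (τ x) = x := Subtype.ext (flip_flip _)
    have htt : (τ x).1.turn = -x.1.turn := turn_flip _
    have r₁ := face_relation hw c x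
    have r₂ := face_relation hw c (τ x)
    rw [← hσ, ← hτ] at r₁ r₂
    rw [ht] at r₂
    simp only [h₀, h₁] at r₁ r₂
    rcases turn_eq_or x.1 with h | h
    · obtain ⟨e₁, e₂⟩ := r₁.1 h
      obtain ⟨e₃, e₄⟩ := r₂.2 (by rw [htt, h])
      rw [h]
      constructor <;> push_cast <;> linarith
    · obtain ⟨e₁, e₂⟩ := r₁.2 h
      obtain ⟨e₃, e₄⟩ := r₂.1 (by rw [htt, h, neg_neg])
      rw [h]
      constructor <;> push_cast <;> linarith
  refine ⟨fun x => if hx : x ∈ w then c (Quot.mk _ (⟨x, hx⟩, 1)) else 0, fun x hx => ?_⟩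
  have := key ⟨x, hx⟩
  simpa [hx, hw.flip_mem x hx, List.next_mem, hσ, hτ, nextPerm, flipPerm] using this

theorem HasNumbering.rotate {u v : GaussCode} (hn : (u ++ v).Nodup)
    (h : (u ++ v).HasNumbering) : (v ++ u).HasNumbering := by
  obtain ⟨a, ha⟩ := h
  refine ⟨a, fun x hx => ?_⟩
  have hr : (u ++ v) ~r (v ++ u) := List.isRotated_append
  have := ha x (hr.mem_iff.2 hx)
  rwa [List.isRotated_next_eq hr hn] at this

theorem next_of_eq_append {w P R : GaussCode} {x y : GaussLetter} (hn : w.Nodup)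
    (h : w = P ++ x :: y :: R) (hx : x ∈ w) : w.next x hx = y := by
  subst h
  have h₁ := List.next_getElem _ hn P.length (by simp)
  have h₂ : (P.length + 1) % (P ++ x :: y :: R).length = P.length + 1 :=
    Nat.mod_eq_of_lt (by simp)
  simp only [h₂] at h₁
  simpa using h₁

theorem numbering_chain {w : GaussCode} (hn : w.Nodup) {a : GaussLetter → ℚ}
    (ha : ∀ x (hx : x ∈ w), a (w.next x hx) = a x - ((x.turn : ℤ) : ℚ)) (A : GaussCode) :
    ∀ (P C : GaussCode) (x y : GaussLetter) (_ : w = P ++ x :: (A ++ y :: C)) (hx : x ∈ w),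
      a y = a (w.next x hx) - (((A.map fun z => (z.turn : ℤ)).sum : ℤ) : ℚ) := by
  induction A with
  | nil =>
    intro P C x y h hx
    rw [next_of_eq_append hn h hx]; simp
  | cons z A ih =>
    intro P C x y h hx
    have hz : z ∈ w := by simp [h]
    rw [next_of_eq_append hn h hx, ih (P ++ [x]) C z y (by simp [h]) hz, ha z hz]
    simp only [List.map_cons, List.sum_cons]
    push_cast
    ring

/-- Between the two passages through a crossing, the knot is crossed as often from the right to the
left as from the left to the right. -/
theorem HasNumbering.sum_turn {w P A C : GaussCode} {x : GaussLetter} (h : w.HasNumbering)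
    (hn : w.Nodup) (hw : w = P ++ x :: (A ++ x.flip :: C)) :
    (A.map fun z => (z.turn : ℤ)).sum = 0 := by
  obtain ⟨a, ha⟩ := h
  have hx : x ∈ w := by simp [hw]
  have h₁ := numbering_chain hn (fun x hx => (ha x hx).1) A P C x x.flip hw hx
  -- The region to the left after `x` and the region to the left before `x.flip` are opposite at the
  -- crossing, so the numbering returns to its value.
  have h₂ := (ha x hx).2
  have : (((A.map fun z => (z.turn : ℤ)).sum : ℤ) : ℚ) = 0 := by linarith
  exact_mod_cast this

end GaussCode

/-! ### The Polyak-Viro sum: elementary changes and independence of the base point -/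

namespace GaussCode

open GaussLetter

/-- The passages `x`, `y` and the other passages through their crossings are met in the order
`x`, `y`, `x.flip`, `y.flip`, which are lower, upper, upper, lower passages. -/
def Chain (w : GaussCode) (x y : GaussLetter) : Prop :=
  x.upper = false ∧ y.upper = true ∧ w.idxOf x < w.idxOf y ∧ w.idxOf y < w.idxOf x.flip ∧
    w.idxOf x.flip < w.idxOf y.flip

instance (w : GaussCode) (x y : GaussLetter) : Decidable (Chain w x y) := by
  unfold Chain; infer_instance

/-- The Polyak-Viro sum for the coefficient `a₂`. -/
def casson (w : GaussCode) : ℤ :=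
  ∑ x ∈ w.toFinset, ∑ y ∈ w.toFinset, if Chain w x y then (x.sign : ℤ) * y.sign else 0

theorem casson_congr {w w' : GaussCode} (hm : ∀ x, x ∈ w ↔ x ∈ w')
    (h : ∀ x ∈ w, ∀ y ∈ w, Chain w x y ↔ Chain w' x y) : w.casson = w'.casson := by
  have : w.toFinset = w'.toFinset := by ext; simp [hm]
  rw [casson, casson, ← this]
  refine Finset.sum_congr rfl fun x hx => Finset.sum_congr rfl fun y hy => ?_
  simp only [h x (by simpa using hx) y (by simpa using hy)]

theorem idxOf_sublist {w w' : GaussCode} (hw : w.Nodup) (hs : w'.Sublist w) {x y : GaussLetter}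
    (hx : x ∈ w') (hy : y ∈ w') : w'.idxOf x < w'.idxOf y ↔ w.idxOf x < w.idxOf y := by
  induction hs with
  | slnil => simp at hx
  | cons a hs ih => grind [List.Sublist.subset]
  | cons_cons a hs ih => grind [List.Sublist.subset]

theorem casson_of_sublist {w w' : GaussCode} (hw : w.Nodup) (hw' : w'.Valid) (hs : w'.Sublist w)
    (h : ∀ x ∈ w, ∀ y ∈ w, Chain w x y → x ∈ w' ∧ y ∈ w') : w.casson = w'.casson := by
  have hsub : w'.toFinset ⊆ w.toFinset := fun x hx => by simpa using hs.subset (by simpa using hx)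
  rw [casson, casson]
  symm
  have key : ∀ x ∈ w', ∀ y ∈ w', (Chain w' x y ↔ Chain w x y) := fun x hx y hy => by
    have hx' := hw'.flip_mem x hx
    have hy' := hw'.flip_mem y hy
    simp only [Chain, idxOf_sublist hw hs hx hy, idxOf_sublist hw hs hy hx',
      idxOf_sublist hw hs hx' hy']
  refine (Finset.sum_congr rfl fun x hx => ?_).trans (Finset.sum_subset hsub fun x hx hx' => ?_)
  · refine (Finset.sum_congr rfl fun y hy => ?_).trans (Finset.sum_subset hsub fun y hy hy' => ?_)
    · simp only [key x (by simpa using hx) y (by simpa using hy)]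
    · rw [if_neg]
      intro hc
      exact hy' (by simpa using (h x (hs.subset (by simpa using hx)) y (by simpa using hy) hc).2)
  · refine Finset.sum_eq_zero fun y hy => ?_
    rw [if_neg]
    intro hc
    exact hx' (by simpa using (h x (by simpa using hx) y (by simpa using hy) hc).1)

theorem idxOf_swap {P Q : GaussCode} {a b x y : GaussLetter} (hn : (P ++ a :: b :: Q).Nodup)
    (h₁ : ¬(x = a ∧ y = b)) (h₂ : ¬(x = b ∧ y = a)) :
    (P ++ a :: b :: Q).idxOf x < (P ++ a :: b :: Q).idxOf y ↔
      (P ++ b :: a :: Q).idxOf x < (P ++ b :: a :: Q).idxOf y := by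
  simp only [List.idxOf_append, List.idxOf_cons]
  grind

/-- A swap of neighbours affects only the comparison between `a` and `b`. `Chain` makes three
comparisons, and each can be this one in two ways, hence the six excluded cases. -/
theorem casson_swap {P Q : GaussCode} {a b : GaussLetter} (hn : (P ++ a :: b :: Q).Nodup)
    (h : ∀ w, w = P ++ a :: b :: Q ∨ w = P ++ b :: a :: Q →
      ¬Chain w a b ∧ ¬Chain w b a ∧ ¬Chain w b.flip a ∧ ¬Chain w a.flip b ∧
      ¬Chain w a.flip b.flip ∧ ¬Chain w b.flip a.flip) :
    (P ++ a :: b :: Q).casson = (P ++ b :: a :: Q).casson := by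
  have hs := h _ (Or.inl rfl)
  have ht := h _ (Or.inr rfl)
  refine casson_congr (fun x => by simp; tauto) fun x _ y _ => ?_
  by_cases c₁ : x = a ∧ y = b
  · rw [c₁.1, c₁.2]; tauto
  by_cases c₂ : x = b ∧ y = a
  · rw [c₂.1, c₂.2]; tauto
  by_cases c₃ : y = a ∧ x.flip = b
  · rw [c₃.1, flip_eq_iff.1 c₃.2]; tauto
  by_cases c₄ : y = b ∧ x.flip = a
  · rw [c₄.1, flip_eq_iff.1 c₄.2]; tauto
  by_cases c₅ : x.flip = a ∧ y.flip = b
  · rw [flip_eq_iff.1 c₅.1, flip_eq_iff.1 c₅.2]; tauto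
  by_cases c₆ : x.flip = b ∧ y.flip = a
  · rw [flip_eq_iff.1 c₆.1, flip_eq_iff.1 c₆.2]; tauto
  simp only [Chain, idxOf_swap hn c₁ c₂, idxOf_swap hn c₃ c₄, idxOf_swap hn c₅ c₆]

/-- None of the comparisons in `Chain` is between two lower passages. -/
theorem casson_swap_lower {P Q : GaussCode} {a b : GaussLetter} (hn : (P ++ a :: b :: Q).Nodup)
    (ha : a.upper = false) (hb : b.upper = false) :
    (P ++ a :: b :: Q).casson = (P ++ b :: a :: Q).casson :=
  casson_swap hn fun w _ => by simp [Chain, ha, hb]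

theorem casson_swap_head {Q : GaussCode} {a b : GaussLetter} (hn : (a :: b :: Q).Nodup)
    (ha : a.upper = true) (hb : b.upper = true) :
    casson (a :: b :: Q) = casson (b :: a :: Q) := by
  refine casson_swap (P := []) hn fun w hw => ?_
  have h₁ : a.flip ≠ b := fun h => by simp [← h, ha] at hb
  have h₂ : b.flip ≠ a := fun h => by simp [← h, hb] at ha
  have h₃ := a.flip_ne
  have h₄ := b.flip_ne
  simp only [Chain, GaussLetter.flip_flip, flip_upper, ha, hb]
  rcases hw with rfl | rfl <;> simp [List.idxOf_cons, h₁.symm, h₂.symm, h₃.symm, h₄.symm]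

/-- The upper passage `a` is one of the first two letters, so it precedes both passages through `c`.
A chain that compares `a.flip` with `c` would need one of these to precede `a`. -/
theorem casson_swap_middle {P Q : GaussCode} {p q a c : GaussLetter}
    (hn : (p :: q :: P ++ a.flip :: c :: Q).Nodup)
    (hp : p.upper = true) (hq : q.upper = true) (hc : c.upper = true) (ha : a = p ∨ a = q) :
    casson (p :: q :: P ++ a.flip :: c :: Q) = casson (p :: q :: P ++ c :: a.flip :: Q) := by
  have hau : a.upper = true := by rcases ha with rfl | rfl <;> assumption
  have h₁ : c.flip ≠ p := fun h => by simp [← h, hc] at hp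
  have h₂ : c.flip ≠ q := fun h => by simp [← h, hc] at hq
  have h₃ : c ≠ a := by rintro rfl; grind
  have h₄ : c ∉ p :: q :: P := by grind
  refine casson_swap hn fun w hw => ?_
  simp only [Chain, GaussLetter.flip_flip, flip_upper, hau, hc]
  have h₅ : ¬w.idxOf c < w.idxOf a := by rcases hw with rfl | rfl <;> grind
  have h₆ : ¬w.idxOf c.flip < w.idxOf a := by rcases hw with rfl | rfl <;> grind
  simp [h₅, h₆]

theorem idxOf_map {g : GaussLetter → GaussLetter} (hg : Function.Injective g) (w : GaussCode)
    (x : GaussLetter) : (w.map g).idxOf (g x) = w.idxOf x := by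
  induction w with
  | nil => rfl
  | cons y w ih =>
    by_cases h : y = x
    · simp [h]
    · simp [List.idxOf_cons_ne _ h, List.idxOf_cons_ne _ (hg.ne h), ih]

theorem relabel_injective {f : ℕ → ℕ} (hf : Function.Injective f) :
    Function.Injective (GaussLetter.relabel f) := by
  intro x y h
  simp only [GaussLetter.relabel, GaussLetter.mk.injEq] at h
  ext1
  · exact hf h.1
  · exact h.2.1
  · exact h.2.2

theorem casson_relabel {f : ℕ → ℕ} (hf : Function.Injective f) (w : GaussCode) :
    casson (w.map (GaussLetter.relabel f)) = casson w := by
  have hg := relabel_injective hf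
  have hfl : ∀ x, (GaussLetter.relabel f x).flip = GaussLetter.relabel f x.flip := fun x => rfl
  have hc : ∀ x y, Chain (w.map (GaussLetter.relabel f)) (GaussLetter.relabel f x)
      (GaussLetter.relabel f y) ↔ Chain w x y := fun x y => by
    simp only [Chain, hfl, idxOf_map hg]
    rfl
  have : (w.map (GaussLetter.relabel f)).toFinset =
      w.toFinset.image (GaussLetter.relabel f) := by ext; simp
  rw [casson, casson, this, Finset.sum_image fun x _ y _ h => hg h]
  refine Finset.sum_congr rfl fun x _ => ?_
  rw [Finset.sum_image fun x _ y _ h => hg h]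
  refine Finset.sum_congr rfl fun y _ => ?_
  simp only [hc]
  rfl

theorem exists_eq_append {w : GaussCode} {x y : GaussLetter} (hx : x ∈ w) (hy : y ∈ w)
    (h : w.idxOf x < w.idxOf y) : ∃ P A C, w = P ++ x :: (A ++ y :: C) := by
  obtain ⟨P, R, rfl, hxP⟩ := List.eq_append_cons_of_mem hx
  have hyR : y ∈ R := by
    by_contra hyR
    have : y ≠ x := by rintro rfl; omega
    have hyP : y ∈ P := by simpa [hyR, this] using hy
    have := List.idxOf_lt_length_of_mem hyP
    simp [List.idxOf_append, hyP, hxP] at h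
    omega
  obtain ⟨A, C, rfl⟩ := List.append_of_mem hyR
  exact ⟨P, A, C, rfl⟩

theorem idxOf_between {P A C : GaussCode} {x y z : GaussLetter}
    (hn : (P ++ x :: (A ++ y :: C)).Nodup) :
    ((P ++ x :: (A ++ y :: C)).idxOf x < (P ++ x :: (A ++ y :: C)).idxOf z ∧
      (P ++ x :: (A ++ y :: C)).idxOf z < (P ++ x :: (A ++ y :: C)).idxOf y) ↔ z ∈ A := by
  simp only [List.idxOf_append, List.idxOf_cons]
  grind

theorem sum_turn_between {w : GaussCode} (hw : w.Valid) (h : w.HasNumbering) {x : GaussLetter}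
    (hx : x ∈ w) (hlt : w.idxOf x < w.idxOf x.flip) :
    ∑ z ∈ w.toFinset,
      (if w.idxOf x < w.idxOf z ∧ w.idxOf z < w.idxOf x.flip then (z.turn : ℤ) else 0) = 0 := by
  obtain ⟨P, A, C, rfl⟩ := exists_eq_append hx (hw.flip_mem x hx) hlt
  have hn := hw.nodup
  have hA : A.Nodup := by grind
  simp only [idxOf_between hn]
  rw [← Finset.sum_filter, ← h.sum_turn hn rfl, ← List.sum_toFinset _ hA]
  refine Finset.sum_congr ?_ fun _ _ => rfl
  ext z
  simp only [Finset.mem_filter, List.mem_toFinset]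
  exact ⟨fun h => h.2, fun h => ⟨by simp [h], h⟩⟩

/-- Crossings with both passages in the interval drop out, as their two turns are opposite. -/
theorem sum_turn_interlaced {w : GaussCode} (hw : w.Valid) (h : w.HasNumbering) {x : GaussLetter}
    (hx : x ∈ w) (hlt : w.idxOf x < w.idxOf x.flip) :
    ∑ z ∈ w.toFinset, (if (w.idxOf x < w.idxOf z ∧ w.idxOf z < w.idxOf x.flip) ∧
      ¬(w.idxOf x < w.idxOf z.flip ∧ w.idxOf z.flip < w.idxOf x.flip)
      then (z.turn : ℤ) else 0) = 0 := by
  have h₁ := sum_turn_between hw h hx hlt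
  have h₂ : ∑ z ∈ w.toFinset, (if (w.idxOf x < w.idxOf z ∧ w.idxOf z < w.idxOf x.flip) ∧
      (w.idxOf x < w.idxOf z.flip ∧ w.idxOf z.flip < w.idxOf x.flip)
      then (z.turn : ℤ) else 0) = 0 := by
    refine Finset.sum_involution (fun z _ => z.flip) (fun z _ => ?_) (fun z _ _ => z.flip_ne)
      (fun z hz => by simpa using hw.flip_mem z (by simpa using hz)) (fun z _ => z.flip_flip)
    simp only [GaussLetter.flip_flip, turn_flip, Units.val_neg]
    by_cases c₁ : w.idxOf x < w.idxOf z ∧ w.idxOf z < w.idxOf x.flip <;>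
      by_cases c₂ : w.idxOf x < w.idxOf z.flip ∧ w.idxOf z.flip < w.idxOf x.flip <;> simp [c₁, c₂]
  refine Eq.trans ?_ (sub_eq_zero.2 (h₁.trans h₂.symm))
  rw [← Finset.sum_sub_distrib]
  refine Finset.sum_congr rfl fun z _ => ?_
  by_cases c₁ : w.idxOf x < w.idxOf z ∧ w.idxOf z < w.idxOf x.flip <;>
    by_cases c₂ : w.idxOf x < w.idxOf z.flip ∧ w.idxOf z.flip < w.idxOf x.flip <;> simp [c₁, c₂]

/-- Only a lower `x` matters. As the first letter it can only begin a chain, and as the last letter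
it can only end one. The difference of the two contributions is the sign of `x` times the sum of the
turns at crossings interlaced with it, which vanishes. -/
theorem casson_rotate_one {x : GaussLetter} {r : GaussCode} (hw : Valid (x :: r))
    (h : HasNumbering (x :: r)) : casson (x :: r) = casson (r ++ [x]) := by
  have hn := hw.nodup
  have hxr : x ∉ r := (List.nodup_cons.1 hn).1
  have hx' : x.flip ∈ r := by
    have := hw.flip_mem x List.mem_cons_self
    simpa [x.flip_ne] using this
  have hr : ∀ z ∈ r, z ≠ x.flip → z.flip ∈ r := fun z hz hzx => by
    have := hw.flip_mem z (List.mem_cons_of_mem _ hz)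
    have hne : z.flip ≠ x := fun h => hzx (flip_eq_iff.1 h)
    simpa [hne] using this
  have i₁ : List.idxOf x (x :: r) = 0 := by simp
  have i₂ : ∀ z ∈ r, List.idxOf z (x :: r) = List.idxOf z r + 1 := fun z hz =>
    List.idxOf_cons_ne _ (by rintro rfl; exact hxr hz)
  have i₃ : List.idxOf x (r ++ [x]) = r.length := by simp [List.idxOf_append, hxr]
  have i₄ : ∀ z ∈ r, List.idxOf z (r ++ [x]) = List.idxOf z r := fun z hz =>
    List.idxOf_append_of_mem hz
  have i₅ : ∀ z ∈ r, List.idxOf z r < r.length := fun z hz => List.idxOf_lt_length_of_mem hz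
  set t : GaussCode → GaussLetter → GaussLetter → ℤ := fun w u v =>
    if Chain w u v then (u.sign : ℤ) * v.sign else 0 with ht
  -- Pairs that do not involve the crossing of `x` contribute equally. What remains is `x` as the
  -- beginning of a chain before the rotation, and `x` as its end, with second crossing `x.flip`,
  -- after it.
  have key : ∀ u ∈ x :: r, ∀ v ∈ x :: r, t (x :: r) u v - t (r ++ [x]) u v =
      (if u = x then t (x :: r) x v else 0) - if v = x.flip then t (r ++ [x]) u x.flip else 0 := by
    intro u hu v hv
    have n₁ : ¬Chain (r ++ [x]) x v := fun hc => by
      have h₁ := hc.2.2.1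
      have : List.idxOf v (r ++ [x]) ≤ r.length := by
        rcases List.mem_cons.1 hv with rfl | hv
        · rw [i₃]
        · rw [i₄ v hv]; exact (i₅ v hv).le
      omega
    have n₂ : ¬Chain (x :: r) u x.flip := fun hc => by
      have h₁ := hc.2.2.2.2
      rw [GaussLetter.flip_flip, i₁] at h₁
      omega
    by_cases hux : u = x
    · subst hux
      by_cases hvx : v = u.flip
      · subst hvx; simp [ht]
      · simp [ht, n₁, hvx]
    · by_cases hvx : v = x.flip
      · subst hvx; simp [ht, n₂, hux]
      · suffices Chain (x :: r) u v ↔ Chain (r ++ [x]) u v by simp [ht, this, hux, hvx]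
        have hur : u ∈ r := by simpa [hux] using hu
        by_cases hvx' : v = x
        · subst hvx'
          refine iff_of_false (fun hc => ?_) fun hc => ?_
          · have := hc.2.2.1; omega
          · have h₁ := hc.2.2.2.1
            by_cases hu' : u = v.flip
            · subst hu'; rw [GaussLetter.flip_flip] at h₁; omega
            · have := hr u hur hu'
              rw [i₃, i₄ _ this] at h₁
              exact absurd h₁ (i₅ _ this).le.not_gt
        have hvr : v ∈ r := by simpa [hvx'] using hv
        have hvr' := hr v hvr hvx
        by_cases hu' : u = x.flip
        · subst hu'
          refine iff_of_false (fun hc => ?_) fun hc => ?_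
          · have := hc.2.2.2.1; rw [GaussLetter.flip_flip] at this; omega
          · have := hc.2.2.2.2
            rw [GaussLetter.flip_flip, i₃, i₄ _ hvr'] at this
            exact absurd this (i₅ _ hvr').le.not_gt
        have hur' := hr u hur hu'
        simp only [Chain, i₂ _ hur, i₂ _ hvr, i₂ _ hur', i₂ _ hvr', i₄ _ hur, i₄ _ hvr, i₄ _ hur',
          i₄ _ hvr', Nat.add_lt_add_iff_right]
  have hset : (r ++ [x]).toFinset = (x :: r).toFinset := by ext; simp
  rw [← sub_eq_zero]
  have e₁ : casson (x :: r) = ∑ u ∈ (x :: r).toFinset, ∑ v ∈ (x :: r).toFinset, t (x :: r) u v := rfl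
  have e₂ : casson (r ++ [x]) =
      ∑ u ∈ (x :: r).toFinset, ∑ v ∈ (x :: r).toFinset, t (r ++ [x]) u v := by
    rw [← hset]; rfl
  have e₃ : casson (x :: r) - casson (r ++ [x]) =
      ∑ z ∈ (x :: r).toFinset, (t (x :: r) x z - t (r ++ [x]) z x.flip) := by
    rw [e₁, e₂, ← Finset.sum_sub_distrib]
    simp only [← Finset.sum_sub_distrib]
    rw [Finset.sum_congr rfl fun u hu => Finset.sum_congr rfl fun v hv =>
      key u (by simpa using hu) v (by simpa using hv)]
    simp only [Finset.sum_sub_distrib]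
    rw [Finset.sum_comm]
    simp [hx', hxr]
  rw [e₃]
  have h₄ := sum_turn_interlaced hw h List.mem_cons_self (x := x) (by rw [i₁, i₂ _ hx']; omega)
  -- An upper `z` comes from a chain before the rotation and a lower `z` from one after it. The
  -- minus sign of the latter is the one in `turn`.
  have e₄ : ∀ z ∈ (x :: r).toFinset, t (x :: r) x z - t (r ++ [x]) z x.flip =
      (if x.upper then 0 else (x.sign : ℤ)) *
        (if (List.idxOf x (x :: r) < List.idxOf z (x :: r) ∧
            List.idxOf z (x :: r) < List.idxOf x.flip (x :: r)) ∧
          ¬(List.idxOf x (x :: r) < List.idxOf z.flip (x :: r) ∧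
            List.idxOf z.flip (x :: r) < List.idxOf x.flip (x :: r))
          then (z.turn : ℤ) else 0) := by
    intro z hz
    have hz : z ∈ x :: r := by simpa using hz
    by_cases hzx : z = x
    · subst hzx; simp [ht, Chain]
    have hzr : z ∈ r := by simpa [hzx] using hz
    by_cases hzx' : z = x.flip
    · subst hzx'; simp [ht, Chain]
    have hzr' := hr z hzr hzx'
    have hne : List.idxOf z.flip r ≠ List.idxOf x.flip r := fun h =>
      hzx (flip_injective ((List.idxOf_inj hzr').1 h))
    have := i₅ _ hzr'
    simp only [ht, Chain, GaussLetter.flip_flip, i₁, i₂ _ hzr, i₂ _ hzr', i₂ _ hx', i₃, i₄ _ hzr,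
      i₄ _ hzr', i₄ _ hx', turn, flip_upper, flip_sign, this]
    rcases hxu : x.upper <;> rcases hzu : z.upper <;> simp <;> split_ifs <;>
      first | omega | (simp; done) | (simp; ring)
  rw [Finset.sum_congr rfl e₄, ← Finset.mul_sum, h₄, mul_zero]

theorem casson_rotate {u v : GaussCode} (hw : (u ++ v).Valid) (h : (u ++ v).HasNumbering) :
    (u ++ v).casson = (v ++ u).casson := by
  induction u generalizing v with
  | nil => simp
  | cons x u ih =>
    have e₁ := casson_rotate_one (x := x) (r := u ++ v) hw h
    have h' : HasNumbering ((u ++ v) ++ [x]) :=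
      HasNumbering.rotate (u := [x]) (v := u ++ v) hw.nodup h
    have hp : ∀ y, y ∈ u ++ (v ++ [x]) ↔ y ∈ x :: u ++ v := fun y => by simp; tauto
    have hw' : Valid (u ++ (v ++ [x])) :=
      ⟨(List.Perm.nodup_iff (by grind)).2 hw.nodup,
        fun y hy => (hp _).2 (hw.flip_mem y ((hp y).1 hy)),
        fun y hy z hz => hw.sign_eq y ((hp y).1 hy) z ((hp z).1 hz)⟩
    rw [List.append_assoc] at h'
    have e₂ := ih hw' h'
    rw [List.cons_append, e₁, List.append_assoc, e₂]
    simp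

theorem pair_one (x y : GaussLetter) : pair 1 x y = [x, y] := rfl

theorem pair_neg_one (x y : GaussLetter) : pair (-1) x y = [y, x] := rfl

end GaussCode

/-! ### Invariance under the Reidemeister moves -/

namespace GaussCode

open GaussLetter

theorem casson_reidemeister1 {x : GaussLetter} {w : GaussCode} (hw : Valid ([x, x.flip] ++ w))
    (hw' : w.Valid) : casson ([x, x.flip] ++ w) = casson w := by
  have hn := hw.nodup
  have h₀ := x.flip_ne
  refine casson_of_sublist hn hw' (List.sublist_append_right _ _) fun u hu v hv hc => ?_
  obtain ⟨hu', hv', h₁, h₂, h₃⟩ := hc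
  have c₁ : u ≠ x := by
    rintro rfl
    simp [List.idxOf_cons] at h₁ h₂ h₃
    grind
  have c₂ : u ≠ x.flip := by
    rintro rfl
    simp [List.idxOf_cons] at h₁ h₂ h₃
  have c₃ : v ≠ x := by
    rintro rfl
    simp at h₁
  have c₄ : v ≠ x.flip := by
    rintro rfl
    simp at h₃
  grind

/-- A chain begins with a lower passage, which comes after two upper letters at the front of the
code. So crossings whose upper passages stand at the front take part in no chain. -/
theorem mem_of_chain_upper {a b u v : GaussLetter} {w : GaussCode}
    (ha : a.upper = true) (hb : b.upper = true) (hc : Chain (a :: b :: w) u v) :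
    u ≠ a ∧ u ≠ b ∧ u ≠ a.flip ∧ u ≠ b.flip ∧ v ≠ a ∧ v ≠ b ∧ v ≠ a.flip ∧ v ≠ b.flip := by
  obtain ⟨hu', hv', h₁, h₂, h₃⟩ := hc
  have hua : u ≠ a := by rintro rfl; simp [ha] at hu'
  have hub : u ≠ b := by rintro rfl; simp [hb] at hu'
  have hlt : 2 ≤ List.idxOf u (a :: b :: w) := by
    rw [List.idxOf_cons_ne _ hua.symm, List.idxOf_cons_ne _ hub.symm]; omega
  have ia : List.idxOf a (a :: b :: w) = 0 := by simp
  have ib : List.idxOf b (a :: b :: w) ≤ 1 := by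
    rw [List.idxOf_cons]; cases (a == b) <;> simp
  refine ⟨hua, hub, ?_, ?_, ?_, ?_, ?_, ?_⟩ <;> rintro rfl <;>
    first
    | omega
    | (rw [GaussLetter.flip_flip] at h₂; omega)
    | simp [ha, hb] at hv'

theorem casson_reidemeister2 {a b : GaussLetter} {w w' : GaussCode}
    (hw : Valid (a :: b :: w)) (hw' : w'.Valid) (hs : w'.Sublist w)
    (hm : ∀ x ∈ w, x ≠ a.flip → x ≠ b.flip → x ∈ w')
    (ha : a.upper = true) (hb : b.upper = true) : casson (a :: b :: w) = casson w' := by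
  refine casson_of_sublist hw.nodup hw' ((hs.cons b).cons a) fun u hu v hv hc => ?_
  have := mem_of_chain_upper ha hb hc
  have hmu := hm u
  have hmv := hm v
  simp only [List.mem_cons] at hu hv
  tauto

theorem casson_pair_head {a b : GaussLetter} {l : ℤˣ} {w : GaussCode}
    (hn : (pair l a b ++ w).Nodup) (ha : a.upper = true) (hb : b.upper = true) :
    casson (pair l a b ++ w) = casson (pair (-l) a b ++ w) := by
  rcases Int.units_eq_one_or l with rfl | rfl
  · exact casson_swap_head hn ha hb
  · rw [neg_neg]
    exact casson_swap_head hn hb ha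

theorem casson_pair_lower {a b : GaussLetter} {l : ℤˣ} {v w : GaussCode}
    (hn : (v ++ pair l a b ++ w).Nodup) (ha : a.upper = false) (hb : b.upper = false) :
    casson (v ++ pair l a b ++ w) = casson (v ++ pair (-l) a b ++ w) := by
  rw [List.append_assoc] at hn ⊢
  rw [List.append_assoc]
  rcases Int.units_eq_one_or l with rfl | rfl
  · exact casson_swap_lower hn ha hb
  · rw [neg_neg]
    exact casson_swap_lower hn hb ha

theorem casson_pair_middle {a b c : GaussLetter} {l m : ℤˣ} {v w : GaussCode}
    (hn : (pair l a b ++ v ++ pair m a.flip c ++ w).Nodup) (ha : a.upper = true)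
    (hb : b.upper = true) (hc : c.upper = true) :
    casson (pair l a b ++ v ++ pair m a.flip c ++ w) =
      casson (pair l a b ++ v ++ pair (-m) a.flip c ++ w) := by
  rw [List.append_assoc] at hn ⊢
  rw [List.append_assoc (pair l a b ++ v) (pair (-m) _ _)]
  rcases Int.units_eq_one_or l with rfl | rfl <;> rcases Int.units_eq_one_or m with rfl | rfl
  · exact casson_swap_middle hn ha hb hc (Or.inl rfl)
  · rw [neg_neg]
    refine (casson_swap_middle (p := a) (q := b) (P := v) ?_ ha hb hc (Or.inl rfl)).symm
    exact (List.Perm.nodup_iff (by simp [pair]; grind)).1 hn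
  · exact casson_swap_middle hn hb ha hc (Or.inr rfl)
  · rw [neg_neg]
    refine (casson_swap_middle (p := b) (q := a) (P := v) ?_ hb ha hc (Or.inr rfl)).symm
    exact (List.Perm.nodup_iff (by simp [pair]; grind)).1 hn

theorem pair_perm (l m : ℤˣ) (x y : GaussLetter) : (pair l x y).Perm (pair m x y) := by
  rcases Int.units_eq_one_or l with rfl | rfl <;> rcases Int.units_eq_one_or m with rfl | rfl <;>
    simp only [pair_one, pair_neg_one] <;> first | exact List.Perm.refl _ | exact List.Perm.swap _ _ _

/-- The move is a product of three swaps of neighbours, each of which preserves the sum: the base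
point is just before the top strand, so its two upper letters lie in no chain; this position also
settles the middle strand; and the bottom strand has two lower letters. -/
theorem casson_reidemeister3_tmb {a b c : GaussLetter} {l m n : ℤˣ} {u v w : GaussCode}
    (hn : (pair l a b ++ u ++ pair m a.flip c ++ v ++ pair n b.flip c.flip ++ w).Nodup)
    (ha : a.upper = true) (hb : b.upper = true) (hc : c.upper = true) :
    casson (pair l a b ++ u ++ pair m a.flip c ++ v ++ pair n b.flip c.flip ++ w) =
      casson (pair (-l) a b ++ u ++ pair (-m) a.flip c ++ v ++ pair (-n) b.flip c.flip ++ w) := by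
  have h₁ : casson (pair l a b ++ u ++ pair m a.flip c ++ v ++ pair n b.flip c.flip ++ w) =
      casson (pair (-l) a b ++ u ++ pair m a.flip c ++ v ++ pair n b.flip c.flip ++ w) := by
    simp only [List.append_assoc] at hn ⊢
    exact casson_pair_head hn ha hb
  have hn₂ : (pair (-l) a b ++ u ++ pair m a.flip c ++ v ++ pair n b.flip c.flip ++ w).Nodup :=
    (List.Perm.nodup_iff (by gcongr; apply pair_perm)).1 hn
  have h₂ : casson (pair (-l) a b ++ u ++ pair m a.flip c ++ v ++ pair n b.flip c.flip ++ w) =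
      casson (pair (-l) a b ++ u ++ pair (-m) a.flip c ++ v ++ pair n b.flip c.flip ++ w) := by
    have := casson_pair_middle (l := -l) (v := u) (m := m) (w := v ++ (pair n b.flip c.flip ++ w))
      (by simpa only [List.append_assoc] using hn₂) ha hb hc
    simpa only [List.append_assoc] using this
  have hn₃ : (pair (-l) a b ++ u ++ pair (-m) a.flip c ++ v ++ pair n b.flip c.flip ++ w).Nodup :=
    (List.Perm.nodup_iff (by gcongr; apply pair_perm)).1 hn₂
  rw [h₁, h₂]
  exact casson_pair_lower hn₃ (by simp [hb]) (by simp [hc])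

theorem casson_reidemeister3_tbm {a b c : GaussLetter} {l m n : ℤˣ} {u v w : GaussCode}
    (hn : (pair l a b ++ u ++ pair n b.flip c.flip ++ v ++ pair m a.flip c ++ w).Nodup)
    (ha : a.upper = true) (hb : b.upper = true) (hc : c.upper = true) :
    casson (pair l a b ++ u ++ pair n b.flip c.flip ++ v ++ pair m a.flip c ++ w) =
      casson (pair (-l) a b ++ u ++ pair (-n) b.flip c.flip ++ v ++ pair (-m) a.flip c ++ w) := by
  have h₁ : casson (pair l a b ++ u ++ pair n b.flip c.flip ++ v ++ pair m a.flip c ++ w) =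
      casson (pair (-l) a b ++ u ++ pair n b.flip c.flip ++ v ++ pair m a.flip c ++ w) := by
    simp only [List.append_assoc] at hn ⊢
    exact casson_pair_head hn ha hb
  have hn₂ : (pair (-l) a b ++ u ++ pair n b.flip c.flip ++ v ++ pair m a.flip c ++ w).Nodup :=
    (List.Perm.nodup_iff (by gcongr; apply pair_perm)).1 hn
  have h₂ : casson (pair (-l) a b ++ u ++ pair n b.flip c.flip ++ v ++ pair m a.flip c ++ w) =
      casson (pair (-l) a b ++ u ++ pair n b.flip c.flip ++ v ++ pair (-m) a.flip c ++ w) := by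
    have := casson_pair_middle (l := -l) (v := u ++ pair n b.flip c.flip ++ v) (m := m) (w := w)
      (by simpa only [List.append_assoc] using hn₂) ha hb hc
    simpa only [List.append_assoc] using this
  have hn₃ : (pair (-l) a b ++ u ++ pair n b.flip c.flip ++ v ++ pair (-m) a.flip c ++ w).Nodup :=
    (List.Perm.nodup_iff (by gcongr; apply pair_perm)).1 hn₂
  have h₃ := casson_pair_lower (v := pair (-l) a b ++ u) (l := n)
    (w := v ++ (pair (-m) a.flip c ++ w)) (by simpa only [List.append_assoc] using hn₃)
    (show b.flip.upper = false by simp [hb]) (show c.flip.upper = false by simp [hc])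
  rw [h₁, h₂]
  simpa only [List.append_assoc] using h₃

/-- The Polyak-Viro sum is invariant under the moves. -/
theorem casson_move {w w' : GaussCode} (hm : Move w w') (hw : w.Valid) (hp : w.Planar)
    (hw' : w'.Valid) : w.casson = w'.casson := by
  cases hm with
  | rotate u v => exact casson_rotate hw (hasNumbering_of_planar hw hp)
  | relabel f hf => exact (casson_relabel hf w).symm
  | reidemeister1 x => exact casson_reidemeister1 hw hw'
  | reidemeister2_parallel a b u v ha hb hab =>
    have hs : List.Sublist (u ++ v) (u ++ [a.flip, b.flip] ++ v) := by simp
    simp only [List.append_assoc, List.cons_append, List.nil_append] at hw hs ⊢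
    exact casson_reidemeister2 hw hw' hs (by simp; grind) ha hb
  | reidemeister2_antiparallel a b u v ha hb hab =>
    have hs : List.Sublist (u ++ v) (u ++ [b.flip, a.flip] ++ v) := by simp
    simp only [List.append_assoc, List.cons_append, List.nil_append] at hw hs ⊢
    exact casson_reidemeister2 hw hw' hs (by simp; grind) ha hb
  | reidemeister3_tmb a b c l m n u v w ha hb hc =>
    exact casson_reidemeister3_tmb hw.nodup ha hb hc
  | reidemeister3_tbm a b c l m n u v w ha hb hc =>
    exact casson_reidemeister3_tbm hw.nodup ha hb hc

end GaussCode

theorem KnotDiagram.casson_eq {D D' : KnotDiagram} (h : D.knot = D'.knot) :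
    D.code.casson = D'.code.casson := by
  have h' : Relation.EqvGen (fun D D' : KnotDiagram => GaussCode.Move D.code D'.code) D D' :=
    Quotient.exact h
  clear h
  induction h' with
  | rel D D' h => exact GaussCode.casson_move h D.valid D.planar D'.valid
  | refl => rfl
  | symm D D' _ ih => exact ih.symm
  | trans D D' D'' _ _ ih₁ ih₂ => exact ih₁.trans ih₂

/-! ### The skein computation of the coefficient of `z ^ 2` -/

namespace GaussCode

open GaussLetter

theorem Valid.eq_or_eq_flip {w : GaussCode} (hw : w.Valid) {x y : GaussLetter} (hx : x ∈ w)
    (hy : y ∈ w) (h : x.crossing = y.crossing) : x = y ∨ x = y.flip := by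
  have hs := hw.sign_eq x hx y hy h
  rcases x with ⟨i, b, s⟩
  rcases y with ⟨j, c, t⟩
  simp only at h hs
  cases b <;> cases c <;> simp [GaussLetter.flip, h, hs]

theorem idxOf_after {P A C : GaussCode} {x y z : GaussLetter}
    (hn : (P ++ x :: (A ++ y :: C)).Nodup) (hz : z ∈ P ++ x :: (A ++ y :: C)) :
    (P ++ x :: (A ++ y :: C)).idxOf y < (P ++ x :: (A ++ y :: C)).idxOf z ↔ z ∈ C := by
  simp only [List.idxOf_append, List.idxOf_cons]
  grind

end GaussCode

namespace LinkCode

open GaussLetter GaussCode Polynomial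

theorem coeff_zero_unlinkValue (L : LinkCode) :
    (unlinkValue L).coeff 0 = if L.length = 1 then 1 else 0 := by
  unfold unlinkValue; split_ifs <;> simp

theorem coeff_succ_unlinkValue (L : LinkCode) (k : ℕ) : (unlinkValue L).coeff (k + 1) = 0 := by
  unfold unlinkValue; split_ifs <;> simp [coeff_one]

theorem coeff_zero_resolve (f : LinkCode → ℤ[X]) (xs : List GaussLetter) (L : LinkCode) :
    (resolve f xs L).coeff 0 = if L.length = 1 then 1 else 0 := by
  induction xs generalizing L with
  | nil => exact coeff_zero_unlinkValue L
  | cons x xs ih => simp [resolve, ih, switch, mul_coeff_zero]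

theorem coeff_zero_conway (n : ℕ) (L : LinkCode) :
    (conway n L).coeff 0 = if L.length = 1 then 1 else 0 := by
  cases n with
  | zero => exact coeff_zero_unlinkValue L
  | succ n => exact coeff_zero_resolve _ _ L

/-- Effect on letters of several successive switches. -/
def switchMap (ys : List GaussLetter) (y : GaussLetter) : GaussLetter :=
  ys.foldl (fun y x => switchAt x y) y

theorem switchMap_cons (x : GaussLetter) (ys : List GaussLetter) (y : GaussLetter) :
    switchMap (x :: ys) y = switchMap ys (switchAt x y) := rfl

/-- The factor `z` in the skein relation lowers the degree by one, and the final unlink has no terms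
of positive degree. When `x` is smoothed, the crossings in the part `ys` of the list before it are
already switched. -/
theorem coeff_succ_resolve (f : LinkCode → ℤ[X]) (k : ℕ) (φ : GaussLetter → ℤ)
    (xs : List GaussLetter) : ∀ L : LinkCode,
    (∀ ys x zs, xs = ys ++ x :: zs →
      (f (smooth x (L.map fun w => w.map (switchMap ys)))).coeff k = φ x) →
    (resolve f xs L).coeff (k + 1) = (xs.map fun x => (x.sign : ℤ) * φ x).sum := by
  induction xs with
  | nil => exact fun L _ => coeff_succ_unlinkValue L k
  | cons x xs ih =>
    intro L h
    have h₁ := h [] x xs rfl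
    have h₂ := ih (switch x L) fun ys y zs hxs => by
      rw [← h (x :: ys) y zs (by rw [hxs]; rfl)]
      simp only [switch, List.map_map]
      congr 4
      funext w
      simp only [Function.comp_apply, List.map_map]
      rfl
    have h₃ : L.map (fun w => w.map (switchMap [])) = L := by
      have : switchMap [] = id := rfl
      simp [this]
    rw [h₃] at h₁
    rw [resolve, coeff_add, h₂, mul_assoc, coeff_intCast_mul, coeff_X_mul, h₁, List.map_cons,
      List.sum_cons, add_comm, Int.cast_id]

theorem switchAt_crossing (x y : GaussLetter) : (switchAt x y).crossing = y.crossing := by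
  unfold switchAt; split_ifs <;> rfl

theorem switchAt_flip (x y : GaussLetter) : (switchAt x y).flip = switchAt x y.flip := by
  by_cases h : y.crossing = x.crossing <;> simp [switchAt, GaussLetter.flip, h]

theorem switchAt_switchAt (x y : GaussLetter) : switchAt x (switchAt x y) = y := by
  by_cases h : y.crossing = x.crossing
  · ext1 <;> simp [switchAt, h]
  · simp [switchAt, h]

theorem switchMap_crossing (ys : List GaussLetter) (y : GaussLetter) :
    (switchMap ys y).crossing = y.crossing := by
  induction ys generalizing y with
  | nil => rfl
  | cons x ys ih => rw [switchMap_cons, ih, switchAt_crossing]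

theorem switchMap_flip (ys : List GaussLetter) (y : GaussLetter) :
    (switchMap ys y).flip = switchMap ys y.flip := by
  induction ys generalizing y with
  | nil => rfl
  | cons x ys ih => rw [switchMap_cons, ih, switchAt_flip, switchMap_cons]

theorem switchMap_injective (ys : List GaussLetter) : Function.Injective (switchMap ys) := by
  induction ys with
  | nil => exact fun _ _ h => h
  | cons x ys ih =>
    intro y z h
    rw [switchMap_cons, switchMap_cons] at h
    rw [← switchAt_switchAt x y, ih h, switchAt_switchAt]

theorem switchMap_of_notMem {ys : List GaussLetter} {y : GaussLetter}
    (h : ∀ x ∈ ys, x.crossing ≠ y.crossing) : switchMap ys y = y := by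
  induction ys with
  | nil => rfl
  | cons x ys ih =>
    have hx : switchAt x y = y := if_neg (h x List.mem_cons_self).symm
    rw [switchMap_cons, hx, ih fun z hz => h z (List.mem_cons_of_mem _ hz)]

theorem switchMap_upper_of_mem {ys : List GaussLetter} {y : GaussLetter}
    (hn : (ys.map crossing).Nodup) (hy : y ∈ ys) : (switchMap ys y).upper = !y.upper := by
  obtain ⟨s, t, rfl⟩ := List.append_of_mem hy
  have hs : switchMap s y = y := switchMap_of_notMem fun x hx h => by
    simp only [List.map_append, List.map_cons, List.nodup_append] at hn
    exact hn.2.2 _ (List.mem_map_of_mem hx) _ List.mem_cons_self h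
  have ht : switchMap t (switchAt y y) = switchAt y y := switchMap_of_notMem fun x hx h => by
    rw [switchAt_crossing] at h
    simp only [List.map_append, List.map_cons, List.nodup_append, List.nodup_cons] at hn
    exact hn.2.1.1 (h ▸ List.mem_map_of_mem hx)
  have : switchMap (s ++ y :: t) y = switchMap t (switchAt y (switchMap s y)) := by
    simp [switchMap]
  rw [this, hs, ht]
  simp [switchAt]

theorem switchMap_sign_eq (ys : List GaussLetter) {y z : GaussLetter}
    (hc : y.crossing = z.crossing) (hs : y.sign = z.sign) :
    (switchMap ys y).sign = (switchMap ys z).sign := by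
  induction ys generalizing y z with
  | nil => exact hs
  | cons x ys ih =>
    rw [switchMap_cons, switchMap_cons]
    refine ih (by rw [switchAt_crossing, switchAt_crossing, hc]) ?_
    unfold switchAt
    rw [hc]
    split_ifs <;> simp [hs]

theorem valid_map_switchMap {w : GaussCode} (hw : w.Valid) (ys : List GaussLetter) :
    GaussCode.Valid (w.map (switchMap ys)) where
  nodup := hw.nodup.map (switchMap_injective ys)
  flip_mem := by
    simp only [List.mem_map, forall_exists_index, and_imp, forall_apply_eq_imp_iff₂]
    exact fun x hx => ⟨x.flip, hw.flip_mem x hx, (switchMap_flip ys x).symm⟩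
  sign_eq := by
    simp only [List.mem_map, forall_exists_index, and_imp, forall_apply_eq_imp_iff₂,
      switchMap_crossing]
    exact fun x hx y hy h => switchMap_sign_eq ys h (hw.sign_eq x hx y hy h)

theorem mem_map_switchMap {ys : List GaussLetter} {x : GaussLetter}
    (h : ∀ y ∈ ys, y.crossing ≠ x.crossing) {w : GaussCode} : x ∈ w.map (switchMap ys) ↔ x ∈ w := by
  conv_lhs => rw [← switchMap_of_notMem h]
  exact List.mem_map_of_injective (switchMap_injective ys)

theorem mem_badLetters {L : LinkCode} {x : GaussLetter} : x ∈ badLetters L ↔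
    x ∈ L.flatten ∧ x.upper = false ∧ L.flatten.idxOf x < L.flatten.idxOf x.flip := by
  rw [badLetters, List.mem_filter]; simp

theorem nodup_crossing_badLetters {L : LinkCode} (hL : GaussCode.Valid L.flatten) :
    ((badLetters L).map crossing).Nodup := by
  refine List.Nodup.map_on (fun x hx y hy h => ?_) (hL.nodup.filter _)
  rw [mem_badLetters] at hx hy
  refine (hL.eq_or_eq_flip hx.1 hy.1 h).resolve_right fun hxy => ?_
  have := hx.2.1
  rw [hxy] at this
  simp [hy.2.1] at this

theorem crossing_ne_of_badLetters {L : LinkCode} (hL : GaussCode.Valid L.flatten)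
    {ys zs : List GaussLetter} {x : GaussLetter} (h : badLetters L = ys ++ x :: zs) :
    ∀ y ∈ ys, y.crossing ≠ x.crossing := by
  have := nodup_crossing_badLetters hL
  rw [h, List.map_append, List.map_cons, List.nodup_append] at this
  exact fun y hy => this.2.2 _ (List.mem_map_of_mem hy) _ List.mem_cons_self

theorem sum_badLetters {L : LinkCode} (hL : GaussCode.Valid L.flatten) (φ : GaussLetter → ℤ) :
    ((badLetters L).map φ).sum = ∑ x ∈ L.flatten.toFinset,
      if x.upper = false ∧ L.flatten.idxOf x < L.flatten.idxOf x.flip then φ x else 0 := by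
  have hn : (badLetters L).Nodup := hL.nodup.filter _
  rw [← List.sum_toFinset _ hn, ← Finset.sum_filter]
  refine Finset.sum_congr ?_ fun _ _ => rfl
  ext x
  rw [List.mem_toFinset, mem_badLetters, Finset.mem_filter, List.mem_toFinset]

/-- A bad crossing of a two-component link is smoothed to a knot exactly if it joins the components.
The order of the passages then puts the lower one on the first component. -/
theorem length_smooth_pair {p q : GaussCode} (hv : GaussCode.Valid (p ++ q)) {x : GaussLetter}
    {ys : List GaussLetter} (hx : x ∈ p ++ q) (h : ∀ y ∈ ys, y.crossing ≠ x.crossing)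
    (hlt : (p ++ q).idxOf x < (p ++ q).idxOf x.flip) :
    (smooth x [p.map (switchMap ys), q.map (switchMap ys)]).length = 1 ↔ x ∈ p ∧ x.flip ∈ q := by
  have hm : ∀ {w : GaussCode}, x ∈ w.map (switchMap ys) ↔ x ∈ w := mem_map_switchMap h
  have hm' : ∀ {w : GaussCode}, x.flip ∈ w.map (switchMap ys) ↔ x.flip ∈ w :=
    mem_map_switchMap (by simpa using h)
  have hf := hv.flip_mem x hx
  have hd := List.nodup_append.1 hv.nodup
  have hdis : ∀ z, z ∈ p → z ∈ q → False := fun z h₁ h₂ => hd.2.2 z h₁ z h₂ rfl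
  have hqp : ¬(x ∈ q ∧ x.flip ∈ p) := fun hqp => by
    have hxp : x ∉ p := fun hxp => hdis x hxp hqp.1
    have := List.idxOf_lt_length_of_mem hqp.2
    rw [List.idxOf_append_of_mem hqp.2, List.idxOf_append_of_notMem hxp] at hlt
    omega
  have d₁ := hdis x
  have d₂ := hdis x.flip
  rw [List.mem_append] at hx hf
  simp only [smooth, List.mem_cons, List.not_mem_nil, or_false, exists_eq_or_imp,
    exists_eq_left, hm, hm']
  by_cases hxp : x ∈ p <;> by_cases hfp : x.flip ∈ p <;> by_cases hxq : x ∈ q <;>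
    by_cases hfq : x.flip ∈ q <;> simp_all

/-- The right-hand side is the linking number, counted at the crossings where `p` runs below `q`.
The constant coefficient does not depend on the recursion depth, so any positive `n` suffices. -/
theorem coeff_one_conway_pair (n : ℕ) {p q : GaussCode} (hv : GaussCode.Valid (p ++ q))
    (hn : n = 0 → p = []) : (conway n [p, q]).coeff 1 =
      ∑ z ∈ p.toFinset, if z.upper = false ∧ z.flip ∈ q then (z.sign : ℤ) else 0 := by
  cases n with
  | zero => rw [hn rfl, conway, coeff_succ_unlinkValue]; simp
  | succ n =>
    have hfl : List.flatten [p, q] = p ++ q := by simp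
    have hv' : GaussCode.Valid (List.flatten [p, q]) := by rwa [hfl]
    rw [conway, coeff_succ_resolve (conway n) 0 (fun x => if x ∈ p ∧ x.flip ∈ q then 1 else 0),
      sum_badLetters hv']
    · rw [hfl]
      have hsub : p.toFinset ⊆ (p ++ q).toFinset := fun z hz => by simp_all
      have hd := (List.nodup_append.1 hv.nodup).2.2
      symm
      refine (Finset.sum_congr rfl fun z hz => ?_).trans
        (Finset.sum_subset hsub fun z _ hz => ?_)
      · have hz : z ∈ p := by simpa using hz
        by_cases hq : z.flip ∈ q
        · have hq' : z.flip ∉ p := fun h => hd _ h _ hq rfl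
          have := List.idxOf_lt_length_of_mem hz
          have : (p ++ q).idxOf z < (p ++ q).idxOf z.flip := by
            rw [List.idxOf_append_of_mem hz, List.idxOf_append_of_notMem hq']; omega
          simp [hz, hq, this]
        · simp [hq]
      · have hz : z ∉ p := by simpa using hz
        simp [hz]
    · intro ys x zs h
      have hb : x ∈ badLetters [p, q] := by rw [h]; simp
      rw [mem_badLetters, hfl] at hb
      rw [coeff_zero_conway, List.map_cons, List.map_cons, List.map_nil]
      simp only [length_smooth_pair hv hb.1 (crossing_ne_of_badLetters hv' h) hb.2.2]

theorem before_append {A R : GaussCode} {x : GaussLetter} (h : x ∉ A) :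
    before x (A ++ x :: R) = A := by
  have h' : ∀ y ∈ A, decide (y ≠ x) = true := fun y hy => by
    simpa using fun hyx : y = x => h (hyx ▸ hy)
  rw [before, List.takeWhile_append_of_pos h', List.takeWhile_cons_of_neg (by simp),
    List.append_nil]

theorem after_append {A R : GaussCode} {x : GaussLetter} (h : x ∉ A) :
    after x (A ++ x :: R) = R := by
  have h' : ∀ y ∈ A, decide (y ≠ x) = true := fun y hy => by
    simpa using fun hyx : y = x => h (hyx ▸ hy)
  rw [after, List.dropWhile_append_of_pos h', List.dropWhile_cons_of_neg (by simp), List.tail_cons]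

theorem smooth_self {A B C : GaussCode} {x : GaussLetter}
    (hn : (A ++ x :: (B ++ x.flip :: C)).Nodup) :
    smooth x [A ++ x :: (B ++ x.flip :: C)] = [A ++ C, B] := by
  have h₁ : x ∉ A := by grind
  have h₂ : x.flip ∉ A ++ x :: B := by grind
  have h₃ : x.flip ∉ B := by grind
  have h₄ : after x.flip (A ++ x :: (B ++ x.flip :: C)) = C := by
    have := after_append (R := C) h₂
    simpa using this
  simp [smooth, before_append h₁, after_append h₁, before_append h₃, h₄]

theorem valid_smooth {A B C : GaussCode} {x : GaussLetter}
    (hw : GaussCode.Valid (A ++ x :: (B ++ x.flip :: C))) : GaussCode.Valid ((A ++ C) ++ B) where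
  nodup := by
    have := hw.nodup
    grind
  flip_mem := by
    intro y hy
    have h₁ := hw.flip_mem y (by grind)
    have h₂ : y ≠ x := by have := hw.nodup; grind
    have h₃ : y ≠ x.flip := by have := hw.nodup; grind
    have h₄ : y.flip ≠ x := fun h => h₃ (flip_eq_iff.1 h)
    have h₅ : y.flip ≠ x.flip := fun h => h₂ (flip_injective h)
    grind
  sign_eq := fun y hy z hz => hw.sign_eq y (by grind) z (by grind)

/-- The passages `z` below which contribute to the linking number of the two components of the
link that is obtained by smoothing at `x`. -/
theorem sum_smooth {A B C : GaussCode} {x : GaussLetter} {ys zs : List GaussLetter}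
    (hw : GaussCode.Valid (A ++ x :: (B ++ x.flip :: C)))
    (hb : badLetters [A ++ x :: (B ++ x.flip :: C)] = ys ++ x :: zs) :
    (∑ z ∈ ((A ++ C).map (switchMap ys)).toFinset,
      if z.upper = false ∧ z.flip ∈ B.map (switchMap ys) then (z.sign : ℤ) else 0) =
    ∑ z ∈ (A ++ x :: (B ++ x.flip :: C)).toFinset,
      if z.upper = false ∧ z.flip ∈ B ∧ z ∈ C then (z.sign : ℤ) else 0 := by
  set w := A ++ x :: (B ++ x.flip :: C) with hwdef
  have hg := switchMap_injective ys
  have hn := hw.nodup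
  have hfl : List.flatten [w] = w := by simp
  have hw' : GaussCode.Valid (List.flatten [w]) := by rwa [hfl]
  have hnys : (ys.map crossing).Nodup := by
    have := nodup_crossing_badLetters hw'
    rw [hb, List.map_append] at this
    exact (List.nodup_append.1 this).1
  have hys : ∀ y ∈ ys, y ∈ w ∧ y.upper = false := fun y hy => by
    have : y ∈ badLetters [w] := by rw [hb]; simp [hy]
    rw [mem_badLetters, hfl] at this
    exact ⟨this.1, this.2.1⟩
  -- Bad letters are listed in the order of the word, so those before `x` are exactly the bad ones
  -- in `A`.
  have hysA : ∀ y, y ∈ ys ↔ y ∈ A ∧ y.upper = false ∧ w.idxOf y < w.idxOf y.flip := by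
    have hxb : x.upper = false ∧ w.idxOf x < w.idxOf x.flip := by
      have : x ∈ badLetters [w] := by rw [hb]; simp
      rw [mem_badLetters, hfl] at this
      exact this.2
    have e : badLetters [w] =
        A.filter (fun x => !x.upper && decide (w.idxOf x < w.idxOf x.flip)) ++ x ::
          (B ++ x.flip :: C).filter (fun x => !x.upper && decide (w.idxOf x < w.idxOf x.flip)) := by
      rw [badLetters, hfl]
      conv_lhs => rw [hwdef]
      rw [List.filter_append, List.filter_cons_of_pos (by simpa using hxb)]
    have hnb : (badLetters [w]).Nodup := hw'.nodup.filter _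
    have hnb' := hnb
    rw [hb] at hnb
    rw [e] at hnb'
    rw [e] at hb
    have h₁ := (List.append_cons_inj_of_notMem (by grind) (by grind)).1 hb
    intro y
    rw [← h₁.1]
    simp
  -- A crossing between `A` and `B` is passed first on `A`, so after the switches it is upper there
  -- and does not count. A crossing between `B` and `C` has no passage on `A` and is unchanged.
  have key : ∀ y ∈ A ++ C, (if (switchMap ys y).upper = false ∧
      (switchMap ys y).flip ∈ B.map (switchMap ys) then ((switchMap ys y).sign : ℤ) else 0) =
      if y.upper = false ∧ y.flip ∈ B ∧ y ∈ C then (y.sign : ℤ) else 0 := by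
    intro y hy
    have hmem : (switchMap ys y).flip ∈ B.map (switchMap ys) ↔ y.flip ∈ B := by
      rw [switchMap_flip]
      exact List.mem_map_of_injective hg
    simp only [hmem]
    by_cases hyB : y.flip ∈ B
    · have hyw : y ∈ w := by grind
      have hfw : y.flip ∈ w := by grind
      have hfA : y.flip ∉ A := by grind
      have hnot : y ∉ ys → switchMap ys y = y := fun hy' => by
        refine switchMap_of_notMem fun z hz hzy => ?_
        rcases hw.eq_or_eq_flip (hys z hz).1 hyw hzy with rfl | rfl
        · exact hy' hz
        · exact hfA ((hysA _).1 hz).1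
      rcases List.mem_append.1 hy with hyA | hyC
      · have hyC : y ∉ C := by grind
        have : (switchMap ys y).upper = true := by
          by_cases hy' : y ∈ ys
          · rw [switchMap_upper_of_mem hnys hy', (hys y hy').2]; rfl
          · rw [hnot hy']
            by_contra hu
            refine hy' ((hysA y).2 ⟨hyA, by simpa using hu, ?_⟩)
            have := List.idxOf_lt_length_of_mem hyA
            rw [hwdef, List.idxOf_append_of_mem hyA, List.idxOf_append_of_notMem hfA]
            omega
        simp [this, hyC]
      · have hy' : y ∉ ys := fun h => by
          have := ((hysA y).1 h).1
          grind
        rw [hnot hy']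
        simp [hyB, hyC]
    · simp [hyB]
  have himg : ((A ++ C).map (switchMap ys)).toFinset = (A ++ C).toFinset.image (switchMap ys) := by
    ext; simp only [List.mem_toFinset, List.mem_map, Finset.mem_image]
  rw [himg, Finset.sum_image fun a _ b _ h => hg h]
  rw [Finset.sum_congr rfl fun y hy => key y (by simpa using hy)]
  refine Finset.sum_subset (fun z hz => by simp [hwdef] at hz ⊢; tauto) fun z _ hz => ?_
  have : z ∉ C := fun h => hz (by simp [h])
  simp [this]

/-- Each bad crossing `x` contributes its sign times a linking number of the smoothed link, and by
`sum_smooth` this counts the lower `z` after `x.flip` whose upper passage lies between `x` and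
`x.flip`. These are the chains from `x` to `z.flip`. -/
theorem coeff_two_conway {w : GaussCode} (hw : w.Valid) :
    (conway w.numCrossings [w]).coeff 2 = w.casson := by
  have hfl : List.flatten [w] = w := by simp
  have hw' : GaussCode.Valid (List.flatten [w]) := by rwa [hfl]
  rcases hN : w.numCrossings with _ | n
  · have : w = [] := by simpa [numCrossings] using hN
    subst this
    rw [conway, coeff_succ_unlinkValue]; rfl
  rw [conway, coeff_succ_resolve (conway n) 1 (fun x => ∑ z ∈ w.toFinset,
    if z.upper = false ∧ (w.idxOf x < w.idxOf z.flip ∧ w.idxOf z.flip < w.idxOf x.flip) ∧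
      w.idxOf x.flip < w.idxOf z then (z.sign : ℤ) else 0), sum_badLetters hw', hfl, casson]
  · refine Finset.sum_congr rfl fun x hx => ?_
    have hre : ∑ y ∈ w.toFinset, (if Chain w x y then (x.sign : ℤ) * y.sign else 0) =
        ∑ z ∈ w.toFinset, if Chain w x z.flip then (x.sign : ℤ) * z.sign else 0 := by
      refine Finset.sum_bij' (fun y _ => y.flip) (fun y _ => y.flip) ?_ ?_ ?_ ?_ ?_
      · exact fun y hy => by simpa using hw.flip_mem y (by simpa using hy)
      · exact fun y hy => by simpa using hw.flip_mem y (by simpa using hy)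
      · exact fun y _ => y.flip_flip
      · exact fun y _ => y.flip_flip
      · exact fun y _ => by simp
    rw [hre]
    by_cases hxb : x.upper = false ∧ w.idxOf x < w.idxOf x.flip
    · rw [if_pos hxb, Finset.mul_sum]
      refine Finset.sum_congr rfl fun z _ => ?_
      rw [mul_ite, mul_zero]
      congr 1
      simp only [Chain, GaussLetter.flip_flip, flip_upper, Bool.not_eq_true', hxb.1, true_and]
      apply propext
      tauto
    · rw [if_neg hxb]
      refine (Finset.sum_eq_zero fun z _ => if_neg fun hc => hxb ⟨hc.1, ?_⟩).symm
      exact hc.2.2.1.trans hc.2.2.2.1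
  · intro ys x zs hb
    have hx : x ∈ badLetters [w] := by rw [hb]; simp
    rw [mem_badLetters, hfl] at hx
    obtain ⟨A, B, C, rfl⟩ := exists_eq_append hx.1 (hw.flip_mem x hx.1) hx.2.2
    have hne := crossing_ne_of_badLetters hw' hb
    have hgx : switchMap ys x = x := switchMap_of_notMem hne
    have hgx' : switchMap ys x.flip = x.flip := by rw [← switchMap_flip, hgx]
    have hmap : (A ++ x :: (B ++ x.flip :: C)).map (switchMap ys) = A.map (switchMap ys) ++
        x :: (B.map (switchMap ys) ++ x.flip :: C.map (switchMap ys)) := by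
      simp [hgx, hgx']
    have hwg := valid_map_switchMap hw ys
    rw [hmap] at hwg
    rw [List.map_cons, List.map_nil, hmap, smooth_self hwg.nodup,
      coeff_one_conway_pair n (valid_smooth hwg), ← List.map_append, sum_smooth hw hb]
    · refine Finset.sum_congr rfl fun z hz => ?_
      congr 1
      apply propext
      rw [idxOf_between hw.nodup, idxOf_after hw.nodup (List.mem_toFinset.1 hz)]
    -- At depth zero the diagram has only the crossing of `x`, so nothing is left of the component
    -- `A ++ C`.
    · rintro rfl
      have h₁ : ∀ y ∈ A ++ x :: (B ++ x.flip :: C), y.crossing = x.crossing := fun y hy =>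
        Finset.card_le_one.1 hN.le _
          (List.mem_toFinset.2 (List.mem_map_of_mem hy)) _
          (List.mem_toFinset.2 (List.mem_map_of_mem hx.1))
      have h₂ : A ++ C = [] := by
        refine List.eq_nil_iff_forall_not_mem.2 fun y hy => ?_
        have hyw : y ∈ A ++ x :: (B ++ x.flip :: C) := by grind
        have hn := hw.nodup
        rcases hw.eq_or_eq_flip hyw hx.1 (h₁ y hyw) with rfl | rfl <;> grind
      rw [← List.map_append, h₂]; rfl

end LinkCode

/-! ### The quadratic bound -/

namespace GaussCode

open GaussLetter

/-- The first passages through the crossings, upper or lower ones according to `b`. -/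
def firsts (w : GaussCode) (b : Bool) : Finset GaussLetter :=
  w.toFinset.filter fun x => x.upper = b ∧ w.idxOf x < w.idxOf x.flip

theorem mem_firsts {w : GaussCode} {b : Bool} {x : GaussLetter} :
    x ∈ w.firsts b ↔ x ∈ w ∧ x.upper = b ∧ w.idxOf x < w.idxOf x.flip := by simp [firsts]

theorem idxOf_ne_flip {w : GaussCode} {x : GaussLetter} (hx : x ∈ w) :
    w.idxOf x ≠ w.idxOf x.flip := fun h => x.ne_flip ((List.idxOf_inj hx).1 h)

theorem sum_firsts {w : GaussCode} (hw : w.Valid) (f : GaussLetter → ℤ) :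
    ∑ z ∈ w.toFinset, f z = ∑ b : Bool, ∑ x ∈ w.firsts b, (f x + f x.flip) := by
  have h₁ : ∀ g : GaussLetter → ℤ, ∑ b : Bool, ∑ x ∈ w.firsts b, g x =
      ∑ x ∈ w.toFinset, if w.idxOf x < w.idxOf x.flip then g x else 0 := fun g => by
    simp only [Fintype.sum_bool, firsts, Finset.sum_filter, ← Finset.sum_add_distrib]
    exact Finset.sum_congr rfl fun x _ => by cases x.upper <;> simp
  have h₂ : ∑ x ∈ w.toFinset, (if w.idxOf x < w.idxOf x.flip then f x.flip else 0) =
      ∑ x ∈ w.toFinset, if w.idxOf x.flip < w.idxOf x then f x else 0 := by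
    refine Finset.sum_bij' (fun y _ => y.flip) (fun y _ => y.flip) ?_ ?_ ?_ ?_ ?_
    · exact fun y hy => by simpa using hw.flip_mem y (by simpa using hy)
    · exact fun y hy => by simpa using hw.flip_mem y (by simpa using hy)
    · exact fun y _ => y.flip_flip
    · exact fun y _ => y.flip_flip
    · exact fun y _ => by simp
  simp only [Finset.sum_add_distrib]
  rw [h₁, h₁, h₂, ← Finset.sum_add_distrib]
  refine Finset.sum_congr rfl fun x hx => ?_
  have := idxOf_ne_flip (w := w) (by simpa using hx : x ∈ w)
  split_ifs <;> omega

theorem card_firsts {w : GaussCode} (hw : w.Valid) :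
    (w.firsts false).card + (w.firsts true).card = w.numCrossings := by
  rw [← Finset.card_union_of_disjoint, numCrossings, ← Finset.card_image_of_injOn (f := crossing)]
  · congr 1
    ext i
    simp only [Finset.mem_image, Finset.mem_union, mem_firsts, List.mem_toFinset, List.mem_map]
    constructor
    · rintro ⟨x, hx | hx, rfl⟩ <;> exact ⟨x, hx.1, rfl⟩
    · rintro ⟨x, hx, rfl⟩
      have hx' := hw.flip_mem x hx
      have hne := idxOf_ne_flip hx
      rcases hne.lt_or_gt with h | h
      · refine ⟨x, ?_, rfl⟩
        cases hu : x.upper <;> simp [hx, h]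
      · refine ⟨x.flip, ?_, rfl⟩
        cases hu : x.upper <;> simp [hx', h, hu]
  · intro x hx y hy h
    have hx' : x ∈ w ∧ w.idxOf x < w.idxOf x.flip := by
      simp only [Finset.coe_union, Set.mem_union, Finset.mem_coe, mem_firsts] at hx; tauto
    have hy' : y ∈ w ∧ w.idxOf y < w.idxOf y.flip := by
      simp only [Finset.coe_union, Set.mem_union, Finset.mem_coe, mem_firsts] at hy; tauto
    refine (hw.eq_or_eq_flip hx'.1 hy'.1 h).resolve_right ?_
    rintro rfl
    have := hx'.2
    rw [GaussLetter.flip_flip] at this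
    exact this.not_gt hy'.2
  · rw [Finset.disjoint_left]
    intro x hx hy
    rw [mem_firsts] at hx hy
    simp [hx.2.1] at hy

/-- `1` if the passages through two crossings alternate, and that of `x` comes first. -/
def interlace (w : GaussCode) (x y : GaussLetter) : ℤ :=
  if w.idxOf x < w.idxOf y ∧ w.idxOf y < w.idxOf x.flip ∧ w.idxOf x.flip < w.idxOf y.flip
  then 1 else 0

theorem casson_eq_sum_interlace (w : GaussCode) : w.casson =
    ∑ x ∈ w.firsts false, ∑ y ∈ w.firsts true, (x.sign : ℤ) * y.sign * interlace w x y := by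
  simp only [casson, firsts, Finset.sum_filter]
  refine Finset.sum_congr rfl fun x _ => ?_
  by_cases hx : x.upper = false ∧ w.idxOf x < w.idxOf x.flip
  · rw [if_pos hx]
    refine Finset.sum_congr rfl fun y _ => ?_
    simp only [interlace, Chain, hx.1, mul_ite, mul_one, mul_zero]
    split_ifs <;> first | rfl | (exfalso; revert hx; grind)
  · rw [if_neg hx]
    exact Finset.sum_eq_zero fun y _ => if_neg fun hc =>
      hx ⟨hc.1, hc.2.2.1.trans hc.2.2.2.1⟩

/-- If both or neither of the passages through `y` lie between those of `x`, both sides vanish.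
Otherwise the crossings are interlaced, and the passage inside is the first one of `y` exactly if
`x` starts first. -/
theorem between_eq_interlace {w : GaussCode} {x y : GaussLetter} (hx : x ∈ w) (hy : y ∈ w)
    (hx' : x.flip ∈ w) (hxlt : w.idxOf x < w.idxOf x.flip) (hylt : w.idxOf y < w.idxOf y.flip) :
    ((if w.idxOf x < w.idxOf y ∧ w.idxOf y < w.idxOf x.flip then (1 : ℤ) else 0) -
      if w.idxOf x < w.idxOf y.flip ∧ w.idxOf y.flip < w.idxOf x.flip then 1 else 0) =
      interlace w x y - interlace w y x := by
  have h₁ : w.idxOf x = w.idxOf y ↔ x = y := List.idxOf_inj hx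
  have h₂ : w.idxOf x.flip = w.idxOf y.flip ↔ x = y :=
    (List.idxOf_inj hx').trans flip_injective.eq_iff
  have h₃ : w.idxOf x = w.idxOf y.flip ↔ x = y.flip := List.idxOf_inj hx
  have h₄ : w.idxOf x.flip = w.idxOf y ↔ x = y.flip := (List.idxOf_inj hx').trans flip_eq_iff
  unfold interlace
  by_cases hxy : x = y
  · subst hxy; simp
  · have hxy' : x ≠ y.flip := by rintro rfl; rw [GaussLetter.flip_flip] at hxlt; omega
    simp only [hxy, hxy', iff_false] at h₁ h₂ h₃ h₄
    split_ifs <;> omega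

/-- This is the vanishing of the sum of turns between `x` and `x.flip`, with the crossings grouped
by whether their first passage is upper or lower. -/
theorem sum_interlace_eq {w : GaussCode} (hw : w.Valid) (h : w.HasNumbering) {x : GaussLetter}
    (hx : x ∈ w) (hlt : w.idxOf x < w.idxOf x.flip) :
    ∑ y ∈ w.firsts true, (y.sign : ℤ) * (interlace w x y - interlace w y x) =
      ∑ y ∈ w.firsts false, (y.sign : ℤ) * (interlace w x y - interlace w y x) := by
  have h₁ := sum_turn_between hw h hx hlt
  have hx' := hw.flip_mem x hx
  rw [sum_firsts hw, Fintype.sum_bool] at h₁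
  have h₂ : ∀ (b : Bool) (t : ℤ), (∀ y : GaussLetter, y.upper = b → (y.turn : ℤ) = t * y.sign) →
      ∑ y ∈ w.firsts b,
        ((if w.idxOf x < w.idxOf y ∧ w.idxOf y < w.idxOf x.flip then (y.turn : ℤ) else 0) +
        if w.idxOf x < w.idxOf y.flip ∧ w.idxOf y.flip < w.idxOf x.flip
          then (y.flip.turn : ℤ) else 0) =
      t * ∑ y ∈ w.firsts b, (y.sign : ℤ) * (interlace w x y - interlace w y x) := by
    intro b t ht
    rw [Finset.mul_sum]
    refine Finset.sum_congr rfl fun y hy => ?_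
    obtain ⟨hy, hb, hylt⟩ := mem_firsts.1 hy
    rw [← between_eq_interlace hx hy hx' hlt hylt, turn_flip, Units.val_neg, ht y hb]
    split_ifs <;> ring
  rw [h₂ true 1 fun y hy => by simp [turn, hy], h₂ false (-1) fun y hy => by simp [turn, hy]] at h₁
  linarith

/-- The Polyak-Viro sum does not change if the knot is seen from the other side. -/
theorem casson_eq_sum_interlace' {w : GaussCode} (hw : w.Valid) (h : w.HasNumbering) : w.casson =
    ∑ x ∈ w.firsts false, ∑ y ∈ w.firsts true, (x.sign : ℤ) * y.sign * interlace w y x := by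
  rw [← sub_eq_zero, casson_eq_sum_interlace, ← Finset.sum_sub_distrib]
  simp only [← Finset.sum_sub_distrib]
  -- The vanishing of turns replaces the inner sum by one over `w.firsts false`; the double sum is
  -- then antisymmetric in `x` and `y`.
  have h₁ : ∑ x ∈ w.firsts false, ∑ y ∈ w.firsts true, ((x.sign : ℤ) * y.sign * interlace w x y -
      (x.sign : ℤ) * y.sign * interlace w y x) =
      ∑ x ∈ w.firsts false, ∑ y ∈ w.firsts false, ((x.sign : ℤ) * y.sign * interlace w x y -
      (x.sign : ℤ) * y.sign * interlace w y x) := by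
    refine Finset.sum_congr rfl fun x hx => ?_
    obtain ⟨hx, _, hlt⟩ := mem_firsts.1 hx
    simp only [mul_assoc, ← mul_sub, ← Finset.mul_sum]
    rw [sum_interlace_eq hw h hx hlt]
  rw [h₁]
  simp only [Finset.sum_sub_distrib]
  rw [sub_eq_zero, Finset.sum_comm]
  exact Finset.sum_congr rfl fun x _ => Finset.sum_congr rfl fun y _ => by ring

theorem two_mul_casson_le {w : GaussCode} (hw : w.Valid) (h : w.HasNumbering) :
    2 * w.casson ≤ (w.firsts false).card * (w.firsts true).card := by
  have h₁ : 2 * w.casson = ∑ x ∈ w.firsts false, ∑ y ∈ w.firsts true,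
      (x.sign : ℤ) * y.sign * (interlace w x y + interlace w y x) := by
    rw [two_mul]
    nth_rw 1 [casson_eq_sum_interlace]
    rw [casson_eq_sum_interlace' hw h]
    simp only [← Finset.sum_add_distrib, mul_add]
  rw [h₁]
  have h₂ : ∀ x y : GaussLetter,
      (x.sign : ℤ) * y.sign * (interlace w x y + interlace w y x) ≤ 1 := fun x y => by
    have h₃ : 0 ≤ interlace w x y + interlace w y x := by
      unfold interlace; split_ifs <;> norm_num
    have h₄ : interlace w x y + interlace w y x ≤ 1 := by
      unfold interlace; split_ifs <;> omega
    rcases Int.units_eq_one_or x.sign with hx | hx <;>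
      rcases Int.units_eq_one_or y.sign with hy | hy <;> rw [hx, hy] <;> simp <;> omega
  refine (Finset.sum_le_sum fun x _ => Finset.sum_le_sum fun y _ => h₂ x y).trans ?_
  simp

theorem firsts_rotate_one {x : GaussLetter} {r : GaussCode} (hw : Valid (x :: r)) :
    firsts (r ++ [x]) x.upper = (firsts (x :: r) x.upper).erase x := by
  have hxr : x ∉ r := (List.nodup_cons.1 hw.nodup).1
  ext z
  rw [Finset.mem_erase, mem_firsts, mem_firsts]
  by_cases hzx : z = x
  · subst hzx
    have h₁ : List.idxOf z (r ++ [z]) = r.length := by simp [List.idxOf_append, hxr]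
    have h₂ : List.idxOf z.flip (r ++ [z]) ≤ r.length := by
      have : z.flip ∈ r := by simpa [z.flip_ne] using hw.flip_mem z List.mem_cons_self
      rw [List.idxOf_append_of_mem this]
      exact (List.idxOf_lt_length_of_mem this).le
    simp only [ne_eq, not_true_eq_false, false_and, iff_false]
    omega
  by_cases hzx' : z = x.flip
  · subst hzx'; simp
  have hzf : z.flip ≠ x := fun h => hzx' (flip_eq_iff.1 h)
  by_cases hzr : z ∈ r
  · have hzr' : z.flip ∈ r := by simpa [hzf] using hw.flip_mem z (List.mem_cons_of_mem _ hzr)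
    rw [List.idxOf_append_of_mem hzr, List.idxOf_append_of_mem hzr',
      List.idxOf_cons_ne _ (Ne.symm hzx), List.idxOf_cons_ne _ hzf.symm]
    simp [hzr, hzx]
  · simp [hzr, hzx]

theorem valid_of_perm {w w' : GaussCode} (hw : w.Valid) (h : w.Perm w') : w'.Valid where
  nodup := h.nodup_iff.1 hw.nodup
  flip_mem := fun x hx => h.mem_iff.1 (hw.flip_mem x (h.mem_iff.2 hx))
  sign_eq := fun x hx y hy => hw.sign_eq x (h.mem_iff.2 hx) y (h.mem_iff.2 hy)

/-- From `4 k l = (k + l)² - (k - l)²`, the case `k ≠ l` is immediate. If `k = l`, moving the first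
letter to the end turns a first passage into a second one, which lowers one of the two counts while
their sum stays the same. -/
theorem eight_mul_casson_le {w : GaussCode} (hw : w.Valid) (h : w.HasNumbering) (hne : w ≠ []) :
    8 * w.casson ≤ (w.numCrossings : ℤ) ^ 2 - 1 := by
  have aux : ∀ {w : GaussCode}, w.Valid → w.HasNumbering →
      (w.firsts false).card ≠ (w.firsts true).card →
      8 * w.casson ≤ (w.numCrossings : ℤ) ^ 2 - 1 := by
    intro w hw h hd
    have h₁ := two_mul_casson_le hw h
    rw [← card_firsts hw]
    have h₂ : ((w.firsts false).card : ℤ) - (w.firsts true).card ≠ 0 := by omega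
    have h₃ : 0 < (((w.firsts false).card : ℤ) - (w.firsts true).card) ^ 2 := by positivity
    push_cast
    nlinarith
  by_cases hd : (w.firsts false).card = (w.firsts true).card
  · obtain ⟨x, r, rfl⟩ := List.exists_cons_of_ne_nil hne
    have hp : List.Perm (x :: r) (r ++ [x]) := (List.perm_append_singleton x r).symm
    have hw' := valid_of_perm hw hp
    have hc : numCrossings (r ++ [x]) = numCrossings (x :: r) := by
      unfold numCrossings
      rw [List.toFinset_eq_of_perm _ _ (hp.map crossing)]
    rw [casson_rotate_one hw h, ← hc]
    refine aux hw' (HasNumbering.rotate (u := [x]) hw.nodup h) fun hd' => ?_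
    have h₁ := card_firsts hw
    have h₂ := card_firsts hw'
    have h₃ := firsts_rotate_one hw
    have hx : x ∈ firsts (x :: r) x.upper := mem_firsts.2 ⟨List.mem_cons_self, rfl, by
      rw [List.idxOf_cons_self, List.idxOf_cons_ne _ x.ne_flip]; omega⟩
    have h₄ := Finset.card_erase_lt_of_mem hx
    rw [← h₃] at h₄
    cases hu : x.upper <;> rw [hu] at h₄ <;> omega
  · exact aux hw h hd

end GaussCode

/-! ### From diagrams to knots -/

theorem KnotDiagram.knot_out (K : Knot) : (Quotient.out K : KnotDiagram).knot = K :=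
  Quotient.out_eq K

theorem KnotDiagram.coeff_two_conway (D : KnotDiagram) : D.conway.coeff 2 = D.code.casson :=
  LinkCode.coeff_two_conway D.valid

theorem KnotDiagram.conwayCoeff_two (D : KnotDiagram) : D.knot.conwayCoeff 2 = D.code.casson := by
  rw [Knot.conwayCoeff, KnotDiagram.coeff_two_conway]
  exact KnotDiagram.casson_eq (KnotDiagram.knot_out D.knot)

theorem Knot.exists_numCrossings_eq (K : Knot) :
    ∃ D : KnotDiagram, D.knot = K ∧ D.numCrossings = K.crossingNumber :=
  Nat.sInf_mem (s := {n : ℕ | ∃ D : KnotDiagram, D.knot = K ∧ D.numCrossings = n})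
    ⟨_, Quotient.out K, KnotDiagram.knot_out K, rfl⟩

theorem Knot.crossingNumber_le (D : KnotDiagram) : D.knot.crossingNumber ≤ D.numCrossings :=
  Nat.sInf_le ⟨D, rfl, rfl⟩

theorem Knot.eight_mul_conwayCoeff_two_le {K : Knot} (hK : K ≠ Knot.unknot) :
    8 * K.conwayCoeff 2 ≤ (K.crossingNumber : ℤ) ^ 2 - 1 := by
  obtain ⟨D, rfl, hD⟩ := K.exists_numCrossings_eq
  rw [← hD, KnotDiagram.conwayCoeff_two]
  refine GaussCode.eight_mul_casson_le D.valid
    (GaussCode.hasNumbering_of_planar D.valid D.planar) fun h => hK ?_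
  have : D = KnotDiagram.trivial := by
    cases D; cases h; rfl
  rw [this]; rfl

theorem Knot.conwayCoeff_two_unknot : Knot.unknot.conwayCoeff 2 = 0 := by
  rw [Knot.unknot, KnotDiagram.conwayCoeff_two]; rfl

/-! ### The torus diagrams -/

namespace GaussCode

open GaussLetter

/-- The `i`-th passage of the standard diagram of a `(2,n)`-torus knot. -/
def torusLetter (n : ℕ) (s : ℤˣ) (i : ℕ) : GaussLetter := ⟨i % n, decide (Even i), s⟩

/-- The code of the standard diagram of a `(2,n)`-torus knot whose crossings have sign `s`. -/
def torusCode (n : ℕ) (s : ℤˣ) : GaussCode := (List.range (2 * n)).map (torusLetter n s)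

theorem torus_eq (p : ℤ) : torus p = torusCode p.natAbs (if 0 < p then 1 else -1) := rfl

variable {n : ℕ} {s : ℤˣ}

/-- By the Chinese remainder theorem for `2` and the odd number `n`, label and parity together
determine the position modulo `2 * n`. -/
theorem torusLetter_eq_iff (hn : Odd n) {i j : ℕ} :
    torusLetter n s i = torusLetter n s j ↔ i ≡ j [MOD 2 * n] := by
  rw [← Nat.modEq_and_modEq_iff_modEq_mul (Nat.coprime_two_left.2 hn)]
  simp only [torusLetter, GaussLetter.mk.injEq, and_true, decide_eq_decide, Nat.ModEq, Nat.even_iff]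
  omega

theorem torusLetter_flip (hn : Odd n) (i : ℕ) :
    (torusLetter n s i).flip = torusLetter n s (i + n) := by
  simp [torusLetter, GaussLetter.flip, Nat.even_add, Nat.not_even_iff_odd.2 hn,
    -Nat.not_even_iff_odd]

theorem torusLetter_mod (hn : Odd n) (i : ℕ) :
    torusLetter n s (i % (2 * n)) = torusLetter n s i :=
  (torusLetter_eq_iff hn).2 (Nat.mod_modEq _ _)

theorem torusLetter_mem (hn : Odd n) (i : ℕ) : torusLetter n s i ∈ torusCode n s := by
  rw [← torusLetter_mod hn]
  exact List.mem_map_of_mem (List.mem_range.2 (Nat.mod_lt _ (by have := hn.pos; omega)))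

theorem exists_of_mem_torusCode {x : GaussLetter} (hx : x ∈ torusCode n s) :
    ∃ i < 2 * n, torusLetter n s i = x := by simpa [torusCode] using hx

theorem length_torusCode : (torusCode n s).length = 2 * n := by simp [torusCode]

theorem nodup_torusCode (hn : Odd n) : (torusCode n s).Nodup := by
  refine List.Nodup.map_on (fun i hi j hj h => ?_) List.nodup_range
  exact Nat.ModEq.eq_of_lt_of_lt ((torusLetter_eq_iff hn).1 h) (List.mem_range.1 hi)
    (List.mem_range.1 hj)

theorem valid_torusCode (hn : Odd n) : (torusCode n s).Valid where
  nodup := nodup_torusCode hn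
  flip_mem := fun x hx => by
    obtain ⟨i, -, rfl⟩ := exists_of_mem_torusCode hx
    rw [torusLetter_flip hn]
    exact torusLetter_mem hn _
  sign_eq := fun x hx y hy _ => by
    obtain ⟨i, -, rfl⟩ := exists_of_mem_torusCode hx
    obtain ⟨j, -, rfl⟩ := exists_of_mem_torusCode hy
    rfl

theorem getElem_torusCode {i : ℕ} (hi : i < (torusCode n s).length) :
    (torusCode n s)[i] = torusLetter n s i := by simp [torusCode]

theorem idxOf_torusLetter (hn : Odd n) (i : ℕ) :
    (torusCode n s).idxOf (torusLetter n s i) = i % (2 * n) := by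
  have hi : i % (2 * n) < (torusCode n s).length := by
    rw [length_torusCode]; exact Nat.mod_lt _ (by have := hn.pos; omega)
  rw [← torusLetter_mod hn, ← getElem_torusCode hi, (nodup_torusCode hn).idxOf_getElem]

theorem next_torusLetter (hn : Odd n) (i : ℕ) (h : torusLetter n s i ∈ torusCode n s) :
    (torusCode n s).next _ h = torusLetter n s (i + 1) := by
  rw [List.next_eq_getElem, getElem_torusCode, torusLetter_eq_iff hn, idxOf_torusLetter hn,
    length_torusCode]
  exact (Nat.mod_modEq _ _).trans ((Nat.mod_modEq _ _).add_right 1)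

theorem prev_torusLetter (hn : Odd n) (i : ℕ) (h : torusLetter n s (i + 1) ∈ torusCode n s) :
    (torusCode n s).prev _ h = torusLetter n s i := by
  have h₁ := List.prev_next _ (nodup_torusCode hn) _ (torusLetter_mem (s := s) hn i)
  simpa only [next_torusLetter hn] using h₁

theorem numCrossings_torusCode (hn : Odd n) : (torusCode n s).numCrossings = n := by
  have : ((torusCode n s).map GaussLetter.crossing).toFinset = Finset.range n := by
    ext i
    simp only [List.mem_toFinset, List.mem_map, Finset.mem_range]
    constructor
    · rintro ⟨x, hx, rfl⟩
      obtain ⟨i, -, rfl⟩ := exists_of_mem_torusCode hx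
      exact Nat.mod_lt _ hn.pos
    · exact fun hi => ⟨_, torusLetter_mem hn i, Nat.mod_eq_of_lt hi⟩
  rw [numCrossings, this, Finset.card_range]

theorem turn_torusLetter (i : ℕ) :
    (torusLetter n s i).turn = if Even i then s else -s := by
  simp [torusLetter, turn]

/-- The face to the left of a dart of the standard diagram of a torus knot: one of the two large
ones, or one of the bigons. -/
def torusFace (n : ℕ) (x : GaussLetter) (d : ℤˣ) : ℤˣ ⊕ ZMod n :=
  if x.turn = 1 then Sum.inl d else Sum.inr (x.crossing + if d = 1 then 0 else 1)

theorem torusFace_step (hn : Odd n) {d d' : Dart (torusCode n s)}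
    (h : FaceStep (torusCode n s) d d') : torusFace n d.1.1 d.2 = torusFace n d'.1.1 d'.2 := by
  obtain ⟨⟨x, hx⟩, e⟩ := d
  obtain ⟨⟨x', hx'⟩, e'⟩ := d'
  obtain ⟨he, hf, hx''⟩ := h
  obtain ⟨i, -, rfl⟩ := exists_of_mem_torusCode hx
  have hn' := hn
  obtain ⟨m, rfl⟩ := hn'
  simp only at he hx'' ⊢
  -- Turning at a crossing shifts the position by `n` and then by one step forward or back. This is
  -- an even shift, so `turn` is preserved along a face.
  have hflip : (torusLetter (2 * m + 1) s i).flip = torusLetter (2 * m + 1) s (i + 2 * m + 1) := by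
    rw [torusLetter_flip hn]; rfl
  have h₁ : x' = if e' = 1 then torusLetter (2 * m + 1) s (i + 2 * m + 2)
      else torusLetter (2 * m + 1) s (i + 2 * m) := by
    rw [hx'']
    simp only [hflip, next_torusLetter hn, prev_torusLetter hn]
  have t₁ : (torusLetter (2 * m + 1) s (i + 2 * m + 2)).turn =
      (torusLetter (2 * m + 1) s i).turn := by simp [turn_torusLetter, Nat.even_add]
  have t₂ : (torusLetter (2 * m + 1) s (i + 2 * m)).turn =
      (torusLetter (2 * m + 1) s i).turn := by simp [turn_torusLetter, Nat.even_add]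
  have ht : x'.turn = (torusLetter (2 * m + 1) s i).turn := by rw [h₁]; split_ifs <;> assumption
  have hz : ((2 * m + 1 : ℕ) : ZMod (2 * m + 1)) = 0 := ZMod.natCast_self _
  push_cast at hz
  unfold torusFace
  rw [ht]
  rcases turn_eq_or (torusLetter (2 * m + 1) s i) with h | h
  · rw [h] at he
    simp [h, he]
  · rw [h] at he
    have hne : (-1 : ℤˣ) ≠ 1 := by decide
    simp only [h, hne, if_false]
    congr 1
    rcases Int.units_eq_one_or e with rfl | rfl
    · have he : e' = -1 := by simpa using he
      subst he
      simp only [hne, if_false] at h₁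
      simp only [h₁, hne, if_true, if_false, torusLetter, ZMod.natCast_mod]
      push_cast
      linear_combination -hz
    · have he : e' = 1 := by simpa using he
      subst he
      simp only [if_true] at h₁
      simp only [h₁, hne, if_true, if_false, torusLetter, ZMod.natCast_mod]
      push_cast
      linear_combination -hz

/-- `torusFace` is constant on faces and takes all `n + 2` values, since the positions `i` and `i +
n` have one label and opposite turns. -/
theorem le_numFaces_torusCode (hn : Odd n) : n + 2 ≤ (torusCode n s).numFaces := by
  have : NeZero n := ⟨hn.pos.ne'⟩
  let φ : Face (torusCode n s) → ℤˣ ⊕ ZMod n :=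
    Quot.lift (fun d => torusFace n d.1.1 d.2) fun _ _ h => torusFace_step hn h
  have hφ : Function.Surjective φ := by
    have hpar : ∀ i : ℕ, ∀ t : ℤˣ, ∃ j, (torusLetter n s j).turn = t ∧ (j : ZMod n) = i := by
      intro i t
      by_cases h : (torusLetter n s i).turn = t
      · exact ⟨i, h, rfl⟩
      · refine ⟨i + n, ?_, by simp⟩
        rw [← torusLetter_flip hn, turn_flip]
        rcases turn_eq_or (torusLetter n s i) with h₁ | h₁ <;>
          rcases Int.units_eq_one_or t with rfl | rfl <;> simp_all
    rintro (d | i)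
    · obtain ⟨j, hj, -⟩ := hpar 0 1
      refine ⟨Quot.mk _ (⟨_, torusLetter_mem hn j⟩, d), ?_⟩
      simp [φ, torusFace, hj]
    · obtain ⟨j, hj, hji⟩ := hpar i.val (-1)
      refine ⟨Quot.mk _ (⟨_, torusLetter_mem hn j⟩, 1), ?_⟩
      change torusFace n (torusLetter n s j) 1 = _
      rw [torusFace, hj, if_neg (by decide), if_pos rfl, add_zero]
      simp [torusLetter, hji]
  have h := Nat.card_le_card_of_surjective φ hφ
  rw [Nat.card_sum, Nat.card_zmod, Nat.card_eq_fintype_card, Fintype.card_units_int] at h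
  change n + 2 ≤ Nat.card (Face (torusCode n s))
  omega

/-- A lower bound for the number of faces is enough, because the Euler characteristic is at most 2
in general. -/
theorem planar_torusCode (hn : Odd n) : (torusCode n s).Planar := by
  have hne : torusCode n s ≠ [] := List.ne_nil_of_mem (torusLetter_mem hn 0)
  refine Or.inr ?_
  have h₁ := numCrossings_add_numFaces_le (torusCode n s) (valid_torusCode hn) hne
  have h₂ := le_numFaces_torusCode (s := s) hn
  rw [numCrossings_torusCode hn, length_torusCode] at *
  omega

theorem chain_torusLetter (hn : Odd n) {i j : ℕ} (hi : i < 2 * n) (hj : j < 2 * n) :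
    Chain (torusCode n s) (torusLetter n s i) (torusLetter n s j) ↔
      (Even j ∧ j < n) ∧ Odd i ∧ i < j := by
  simp only [Chain, torusLetter_flip hn, idxOf_torusLetter hn, Nat.mod_eq_of_lt hi,
    Nat.mod_eq_of_lt hj]
  have h₁ : (i + n) % (2 * n) = if i < n then i + n else i - n := by
    split_ifs
    · exact Nat.mod_eq_of_lt (by omega)
    · rw [show i + n = i - n + 2 * n by omega, Nat.add_mod_right, Nat.mod_eq_of_lt (by omega)]
  have h₂ : (j + n) % (2 * n) = if j < n then j + n else j - n := by
    split_ifs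
    · exact Nat.mod_eq_of_lt (by omega)
    · rw [show j + n = j - n + 2 * n by omega, Nat.add_mod_right, Nat.mod_eq_of_lt (by omega)]
  rw [h₁, h₂]
  simp only [torusLetter, decide_eq_false_iff_not, decide_eq_true_eq, Nat.not_even_iff_odd]
  by_cases c₁ : i < n <;> by_cases c₂ : j < n <;> simp only [c₁, c₂, if_true, if_false] <;>
    simp only [and_true, and_false, false_and, iff_false] <;> grind

theorem card_odd_lt (j : ℕ) : ∑ i ∈ Finset.range j, (if Odd i then (1 : ℤ) else 0) = (j / 2 : ℕ) := by
  induction j with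
  | zero => rfl
  | succ j ih =>
    rw [Finset.sum_range_succ, ih]
    rcases Nat.even_or_odd j with ⟨k, rfl⟩ | ⟨k, rfl⟩
    · rw [if_neg (by simp)]; push_cast; omega
    · rw [if_pos (by simp)]; push_cast; omega

theorem two_mul_sum_half (m : ℕ) :
    2 * ∑ j ∈ Finset.range (2 * m + 1), (if Even j then ((j / 2 : ℕ) : ℤ) else 0) = m * (m + 1) := by
  induction m with
  | zero => rfl
  | succ m ih =>
    rw [show 2 * (m + 1) + 1 = 2 * m + 1 + 1 + 1 by ring, Finset.sum_range_succ,
      Finset.sum_range_succ, mul_add, mul_add, ih, if_neg (by simp), if_pos (by simp [Nat.even_add])]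
    rw [show (2 * m + 1 + 1) / 2 = m + 1 by omega]
    push_cast
    ring

/-- All products of signs are 1, and the chains correspond to pairs of an odd `i` and an even `j`
with `i < j < n`. Each even `j` has `j / 2` partners, which gives `0 + 1 + ⋯ + m`. -/
theorem two_mul_casson_torusCode (m : ℕ) :
    2 * (torusCode (2 * m + 1) s).casson = m * (m + 1) := by
  have hn : Odd (2 * m + 1) := ⟨m, rfl⟩
  set n := 2 * m + 1 with hndef
  have himg : (torusCode n s).toFinset = (Finset.range (2 * n)).image (torusLetter n s) := by
    ext; simp [torusCode]
  have hinj : Set.InjOn (torusLetter n s) (Finset.range (2 * n)) := fun i hi j hj h =>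
    Nat.ModEq.eq_of_lt_of_lt ((torusLetter_eq_iff hn).1 h) (by simpa using hi) (by simpa using hj)
  have h₁ : (torusCode n s).casson = ∑ j ∈ Finset.range n,
      (if Even j then ((j / 2 : ℕ) : ℤ) else 0) := by
    rw [casson, himg, Finset.sum_image hinj, Finset.sum_congr rfl fun i _ => Finset.sum_image hinj,
      Finset.sum_comm]
    symm
    refine (Finset.sum_congr rfl fun j hj => ?_).trans (Finset.sum_subset
      (Finset.range_subset_range.2 (by omega : n ≤ 2 * n)) fun j hj hj' => ?_)
    · have hj : j < n := Finset.mem_range.1 hj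
      rw [← card_odd_lt]
      have : ∀ i ∈ Finset.range (2 * n),
          (if Chain (torusCode n s) (torusLetter n s i) (torusLetter n s j) then
            ((torusLetter n s i).sign : ℤ) * (torusLetter n s j).sign else 0) =
          if Even j ∧ Odd i ∧ i < j then 1 else 0 := fun i hi => by
        have hs : ((torusLetter n s i).sign : ℤ) * (torusLetter n s j).sign = 1 := by
          rcases Int.units_eq_one_or s with rfl | rfl <;> rfl
        simp only [chain_torusLetter hn (Finset.mem_range.1 hi) (by omega : j < 2 * n), hs, hj,
          and_true]
      rw [Finset.sum_congr rfl this]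
      split_ifs with he
      · refine (Finset.sum_congr rfl fun i hi => ?_).trans (Finset.sum_subset
          (Finset.range_subset_range.2 (by omega : j ≤ 2 * n)) fun i hi hi' => ?_)
        · simp [he, Finset.mem_range.1 hi]
        · have : ¬i < j := by simpa using hi'
          simp [this]
      · simp [he]
    · refine Finset.sum_eq_zero fun i hi => if_neg fun hc => hj' ?_
      rw [chain_torusLetter hn (Finset.mem_range.1 hi) (Finset.mem_range.1 hj)] at hc
      exact Finset.mem_range.2 hc.1.2
  rw [h₁, hndef, two_mul_sum_half]

end GaussCode

/-- The standard diagram of the `(2,p)`-torus knot. -/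
def KnotDiagram.torus (p : ℤ) (hp : Odd p) : KnotDiagram where
  code := GaussCode.torus p
  valid := GaussCode.valid_torusCode (Int.natAbs_odd.2 hp)
  planar := GaussCode.planar_torusCode (Int.natAbs_odd.2 hp)

theorem KnotDiagram.eight_mul_conwayCoeff_two_torus (p : ℤ) (hp : Odd p) :
    8 * (KnotDiagram.torus p hp).knot.conwayCoeff 2 = (p.natAbs : ℤ) ^ 2 - 1 := by
  rw [KnotDiagram.conwayCoeff_two]
  obtain ⟨m, hm⟩ := Int.natAbs_odd.2 hp
  have := GaussCode.two_mul_casson_torusCode (s := if 0 < p then 1 else -1) m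
  change 8 * GaussCode.casson (GaussCode.torus p) = _
  rw [GaussCode.torus_eq, hm]
  push_cast
  linear_combination 4 * this

theorem proposition3p4 :
    (∀ D : KnotDiagram, D.conway.coeff 2 = D.knot.conwayCoeff 2) ∧
    (∀ K : Knot, K ≠ Knot.unknot →
      (K.conwayCoeff 2 : ℚ) ≤ ((K.crossingNumber : ℚ) ^ 2 - 1) / 8) ∧
    (∀ p : ℤ, Odd p → 3 ≤ |p| →
      ∃ D : KnotDiagram, D.code = GaussCode.torus p ∧ D.knot ≠ Knot.unknot ∧
        (D.knot.conwayCoeff 2 : ℚ) = ((D.knot.crossingNumber : ℚ) ^ 2 - 1) / 8) := by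
  refine ⟨fun D => by rw [D.coeff_two_conway, D.conwayCoeff_two], fun K hK => ?_,
    fun p hp h3 => ⟨KnotDiagram.torus p hp, rfl, ?_, ?_⟩⟩
  · have := Knot.eight_mul_conwayCoeff_two_le hK
    rw [le_div_iff₀ (by norm_num)]
    have : ((8 * K.conwayCoeff 2 : ℤ) : ℚ) ≤ (((K.crossingNumber : ℤ) ^ 2 - 1 : ℤ) : ℚ) := by
      exact_mod_cast this
    push_cast at this
    linarith
  all_goals
    have h₁ := KnotDiagram.eight_mul_conwayCoeff_two_torus p hp
    have h₂ : (3 : ℤ) ≤ p.natAbs := by rwa [Int.natCast_natAbs]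
    have hne : (KnotDiagram.torus p hp).knot ≠ Knot.unknot := fun h => by
      rw [h, Knot.conwayCoeff_two_unknot] at h₁
      nlinarith
  · exact hne
  · have h₃ := Knot.eight_mul_conwayCoeff_two_le hne
    have h₄ : (KnotDiagram.torus p hp).knot.crossingNumber ≤ p.natAbs := by
      refine (Knot.crossingNumber_le _).trans_eq ?_
      exact GaussCode.numCrossings_torusCode (Int.natAbs_odd.2 hp)
    -- The general bound, applied to the known value of `a₂`, excludes diagrams with fewer
    -- crossings.
    have h₅ : (KnotDiagram.torus p hp).knot.crossingNumber = p.natAbs := by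
      refine le_antisymm h₄ ?_
      rw [h₁] at h₃
      have : (p.natAbs : ℤ) ^ 2 ≤ ((KnotDiagram.torus p hp).knot.crossingNumber : ℤ) ^ 2 := by
        linarith
      exact_mod_cast (pow_le_pow_iff_left₀ (by positivity) (by positivity) two_ne_zero).1 this
    rw [h₅, eq_div_iff (by norm_num)]
    generalize p.natAbs = q at h₁ ⊢
    have h₆ : ((8 * (KnotDiagram.torus p hp).knot.conwayCoeff 2 : ℤ) : ℚ) =
        (((q : ℤ) ^ 2 - 1 : ℤ) : ℚ) := by rw [h₁]
    push_cast at h₆ ⊢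
    linarith
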